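/- Let $k$ be a commutative ring, $H$ a $k$-bialgebra, $A$ a left $H$-comodule algebra with coaction $a\mapsto\sum a_{<-1>}\otimes a_{<0>}$, and $C$ a right $H$-module coalgebra that is flat over $k$ (a Doi-Hopf datum $(H,A,C)$). In what is said below about $V$, $V_3$ and $V_4$, ``$k$-algebra'' means an associative, not necessarily unital $k$-algebra, and homomorphisms and subalgebras are understood accordingly. A Doi-Hopf module is a right $A$-module and left $C$-comodule $M$ with $\rho_M(ma)=\sum m_{<-1>}\cdot a_{<-1>}\otimes m_{<0>}a_{<0>}$; let $\mathcal C$ be the category of Doi-Hopf modules and $A$-linear $C$-colinear maps, $F:\mathcal C\to\mathcal M_A$ the functor that forgets the coaction, $G:\mathcal M_A\to\mathcal C$ its right adjoint $G(N)=C\otimes N$, with $(c\otimes n)a=\sum c\cdot a_{<-1>}\otimes na_{<0>}$ and $\rho(c\otimes n)=\sum c_{(1)}\otimes c_{(2)}\otimes n$, and $\rho:1\to GF$ the unit, given by the coactions. Let $V$ be the $k$-algebra of natural transformations $\nu:GF\to 1$, with pointwise addition and scalar multiplication and product $\nu\bullet\nu'=\nu'\circ\rho\circ\nu$. For a right $H$-module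 coalgebra $D$, Koppinen's smash product $\#(D,A)$ is the $k$-algebra ${\rm Hom}(D,A)$ with product $(f\bullet g)(d)=\sum f(d_{(1)})_{<0>}\,g(d_{(2)}\cdot f(d_{(1)})_{<-1>})$. Let $H$ act on $C^{\rm cop}\otimes C$ by $(c\otimes d)\cdot h=c\otimes d\cdot h$. Let $V_3\subset\#(C^{\rm cop}\otimes C,A)$ be the set of $k$-linear $\theta:C\otimes C\to A$ such that, for all $c,d\in C$ and $a\in A$, $$\theta(c\otimes d)a=\sum a_{<0>}\theta(c\cdot a_{<-2>}\otimes d\cdot a_{<-1>}),\qquad \sum c_{(1)}\otimes\theta(c_{(2)}\otimes d)=\sum d_{(2)}\cdot\theta(c\otimes d_{(1)})_{<-1>}\otimes\theta(c\otimes d_{(1)})_{<0>}.$$ Let $V_4$ be the set of $k$-linear $\gamma:C\to{\rm Hom}(C,A)$ for which $c\otimes d\mapsto\gamma(c)(d)$ satisfies these two conditions, inside the convolution algebra ${\rm Hom}(C^{\rm cop},\#(C,A))$. Call $\theta\in V_3$ (resp. $\gamma\in V_4$) normalized if $\sum\theta(c_{(1)}\otimes c_{(2)})=\varepsilon(c)1_A$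 (resp. $\sum\gamma(c_{(1)})(c_{(2)})=\varepsilon(c)1_A$) for all $c\in C$. Theorem. $V_3$ is a $k$-subalgebra of $\#(C^{\rm cop}\otimes C,A)$ and $V_4$ is a $k$-subalgebra of ${\rm Hom}(C^{\rm cop},\#(C,A))$. Let $h=g\circ g_1\circ g_2$, where $g_2(\theta)=\lambda$ with $\lambda(c\otimes d)=\sum c_{(1)}\otimes\theta(c_{(2)}\otimes d)$, $g_1(\lambda)=\nu$ with $\nu(c\otimes d\otimes a)=a\lambda(c\otimes d)$ (where $a(c\otimes b)=c\otimes ab$), and $g(\nu)_M(c\otimes m)=\sum m_{<0>}\bigl((\varepsilon_C\otimes I_A)\nu(c\otimes m_{<-1>}\otimes 1_A)\bigr)$ for every Doi-Hopf module $M$. Then $h$ is a well-defined $k$-algebra homomorphism $V_3\to V$. The map $f_3:V_3\to V_4$, $f_3(\theta)(c)(d)=\theta(c\otimes d)$, is an isomorphism of $k$-algebras. If $H$ is a Hopf algebra, then $h$ is bijective, so that $V$, $V_3$ and $V_4$ are isomorphic as $k$-algebras. Normalized elements of $V_3$ and of $V_4$ are right units of these algebras, and every $\nu\in V$ with $\nu\circ\rho=1$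 is a right unit of $V$. -/

import Mathlib

open TensorProduct Coalgebra CategoryTheory MulOpposite

universe u

namespace DoiHopf

noncomputable section

/-! ### Right modules, left comodules, comodule algebras, module coalgebras

A right module over a `k`-algebra `A` is a `k`-module `M` with a compatible `Module Aᵐᵒᵖ M`:
the element `m · a` is written `op a • m`. -/

section Basic

variable (k : Type*) [CommRing k]

/-- The right action `m ↦ a ↦ m · a` as a `k`-bilinear map. -/
def ract {A M : Type*} [Ring A] [Algebra k A] [AddCommGroup M] [Module k M] [Module Aᵐᵒᵖ M]
    [IsScalarTower k Aᵐᵒᵖ M] : M →ₗ[k] A →ₗ[k] M :=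
  LinearMap.mk₂ k (fun m a => op a • m)
    (fun m n a => smul_add _ m n)
    (fun x m a => by
      rw [← one_smul Aᵐᵒᵖ m, ← smul_assoc x (1 : Aᵐᵒᵖ) m, ← mul_smul, mul_smul_comm, mul_one,
        one_smul, smul_assoc])
    (fun m a b => by rw [MulOpposite.op_add, add_smul])
    (fun x m a => by rw [MulOpposite.op_smul, smul_assoc])

@[simp] theorem ract_apply {A M : Type*} [Ring A] [Algebra k A] [AddCommGroup M] [Module k M]
    [Module Aᵐᵒᵖ M] [IsScalarTower k Aᵐᵒᵖ M] (m : M) (a : A) : ract k m a = op a • m := rfl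

/-- The right `A`-module structure with action a given `k`-bilinear map. -/
@[reducible] def rightModuleOfAct {A M : Type*} [Ring A] [Algebra k A] [AddCommGroup M]
    [Module k M] (act : M →ₗ[k] A →ₗ[k] M) (hone : ∀ m, act m 1 = m)
    (hmul : ∀ m a b, act m (a * b) = act (act m a) b) : Module Aᵐᵒᵖ M where
  smul a m := act m (unop a)
  one_smul m := hone m
  mul_smul a b m := hmul m (unop b) (unop a)
  smul_zero a := by change act 0 (unop a) = 0; simp
  smul_add a m n := by change act (m + n) (unop a) = act m (unop a) + act n (unop a); simp
  add_smul a b m := by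
    change act m (unop a + unop b) = act m (unop a) + act m (unop b); simp
  zero_smul m := by change act m 0 = 0; simp

/-- A left comodule over the `k`-coalgebra `C`, with coaction
`m ↦ ∑ m₍₋₁₎ ⊗ m₍₀₎ ∈ C ⊗ M`. -/
class LeftComodule (C M : Type*) [AddCommGroup C] [Module k C] [Coalgebra k C]
    [AddCommGroup M] [Module k M] where
  /-- the coaction -/
  coact : M →ₗ[k] C ⊗[k] M
  coassoc : ∀ m : M, TensorProduct.assoc k C C M ((comul (R := k)).rTensor M (coact m)) =
    coact.lTensor C (coact m)
  counit_coact : ∀ m : M, TensorProduct.lid k M ((counit (R := k)).rTensor M (coact m)) = m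

/-- The coaction `M → C ⊗ M` of a left `C`-comodule. -/
def coact (C : Type*) {M : Type*} [AddCommGroup C] [Module k C] [Coalgebra k C]
    [AddCommGroup M] [Module k M] [LeftComodule k C M] : M →ₗ[k] C ⊗[k] M :=
  LeftComodule.coact

/-- A left `H`-comodule algebra: a `k`-algebra and left `H`-comodule whose coaction is
an algebra map `A → H ⊗ A`. -/
class ComoduleAlgebra (H A : Type*) [Ring H] [Bialgebra k H] [Ring A] [Algebra k A]
    extends LeftComodule k H A where
  coact_mul : ∀ a b : A, coact (a * b) = coact a * coact b
  coact_one : coact (1 : A) = 1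

/-- A right `H`-module coalgebra: a `k`-coalgebra and right `H`-module with
`Δ(c·h) = ∑ c₍₁₎·h₍₁₎ ⊗ c₍₂₎·h₍₂₎` and `ε(c·h) = ε(c)ε(h)`. -/
class ModuleCoalgebra (H C : Type*) [Ring H] [Bialgebra k H] [AddCommGroup C] [Module k C]
    [Coalgebra k C] [Module Hᵐᵒᵖ C] [IsScalarTower k Hᵐᵒᵖ C] : Prop where
  comul_act : ∀ (c : C) (h : H), comul (R := k) (op h • c) =
    map₂ (ract k) (ract k) (comul (R := k) c) (comul (R := k) h)
  counit_act : ∀ (c : C) (h : H),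
    counit (R := k) (op h • c) = counit (R := k) c * counit (R := k) h

/-- `x ⊗ y ↦ y * x`. -/
def opMul (A : Type*) [Ring A] [Algebra k A] : A ⊗[k] A →ₗ[k] A :=
  LinearMap.mul' k A ∘ₗ (TensorProduct.comm k A A).toLinearMap

@[simp] theorem opMul_tmul {A : Type*} [Ring A] [Algebra k A] (x y : A) :
    opMul k A (x ⊗ₜ y) = y * x := by simp [opMul]

/-- The map `d ↦ x ↦ ∑ d · x₍₋₁₎ ⊗ x₍₀₎`. -/
def twist (H A C : Type*) [Ring H] [Bialgebra k H] [Ring A] [Algebra k A]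
    [ComoduleAlgebra k H A] [AddCommGroup C] [Module k C] [Module Hᵐᵒᵖ C]
    [IsScalarTower k Hᵐᵒᵖ C] : C →ₗ[k] A →ₗ[k] C ⊗[k] A :=
  (LinearMap.rTensorHom A ∘ₗ ract k (A := H) (M := C)).compl₂ (coact k H)

end Basic

/-! ### The co-opposite coalgebra -/

section Cop

/-- The `k`-module underlying `C`, to be equipped with the co-opposite comultiplication. -/
def Cop (C : Type*) : Type _ := C

variable (k : Type*) [CommRing k] {C : Type*} [AddCommGroup C] [Module k C]

instance : AddCommGroup (Cop C) := inferInstanceAs (AddCommGroup C)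
instance : Module k (Cop C) := inferInstanceAs (Module k C)

/-- The identity map `C → C^cop`. -/
def toCop : C ≃ₗ[k] Cop C := LinearEquiv.refl k C

variable [Coalgebra k C]

theorem comm_coassoc (x : C) :
    TensorProduct.assoc k C C C (((TensorProduct.comm k C C).toLinearMap ∘ₗ comul).rTensor C
      (TensorProduct.comm k C C (comul x))) =
    ((TensorProduct.comm k C C).toLinearMap ∘ₗ comul).lTensor C
      (TensorProduct.comm k C C (comul x)) := by
  have key : ∀ (w : C ⊗[k] C),
      TensorProduct.assoc k C C C (((TensorProduct.comm k C C).toLinearMap ∘ₗ comul).rTensor C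
        (TensorProduct.comm k C C w)) = (TensorProduct.comm k C C).toLinearMap.lTensor C
          ((TensorProduct.comm k (C ⊗[k] C) C) ((TensorProduct.assoc k C C C).symm
            ((comul (R := k)).lTensor C w))) := by
    intro w
    induction w with
    | zero => simp
    | add x y hx hy => simp only [map_add, hx, hy]
    | tmul a b =>
      simp only [TensorProduct.comm_tmul, LinearMap.rTensor_tmul, LinearMap.lTensor_tmul,
        LinearMap.comp_apply, LinearEquiv.coe_coe]
      induction comul (R := k) b with
      | zero => simp
      | add x y hx hy => simp only [map_add, tmul_add, add_tmul, hx, hy]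
      | tmul c d => simp
  have key2 : ∀ (w : C ⊗[k] C),
      ((TensorProduct.comm k C C).toLinearMap ∘ₗ comul).lTensor C (TensorProduct.comm k C C w) =
        (TensorProduct.comm k C C).toLinearMap.lTensor C
          ((TensorProduct.comm k (C ⊗[k] C) C) ((comul (R := k)).rTensor C w)) := by
    intro w
    induction w with
    | zero => simp
    | add x y hx hy => simp only [map_add, hx, hy]
    | tmul a b => simp
  rw [key, key2, ← coassoc_apply, LinearEquiv.symm_apply_apply]

variable (C) in
/-- The co-opposite coalgebra structure on `C`: comultiplication `c ↦ ∑ c₍₂₎ ⊗ c₍₁₎`, with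
the same counit. -/
@[reducible] def copCoalgebra : Coalgebra k C where
  comul := (TensorProduct.comm k C C).toLinearMap ∘ₗ comul
  counit := counit
  coassoc := by
    ext x
    exact comm_coassoc k (C := C) x
  rTensor_counit_comp_comul := by
    ext x
    change (counit (R := k)).rTensor C (TensorProduct.comm k C C (comul (R := k) (A := C) x)) =
      1 ⊗ₜ x
    rw [← TensorProduct.comm_tmul, ← lTensor_counit_comul]
    induction comul (R := k) (A := C) x with
    | zero => simp
    | add x y hx hy => simp only [map_add, hx, hy]
    | tmul a b => simp
  lTensor_counit_comp_comul := by
    ext x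
    change (counit (R := k)).lTensor C (TensorProduct.comm k C C (comul (R := k) (A := C) x)) =
      x ⊗ₜ 1
    rw [← TensorProduct.comm_tmul, ← rTensor_counit_comul]
    induction comul (R := k) (A := C) x with
    | zero => simp
    | add x y hx hy => simp only [map_add, hx, hy]
    | tmul a b => simp

/-- The coalgebra `C^cop`. -/
instance : Coalgebra k (Cop C) := copCoalgebra k C

theorem comul_toCop (c : C) : comul (R := k) (toCop k c) =
    TensorProduct.map (toCop k).toLinearMap (toCop k).toLinearMap
      (TensorProduct.comm k C C (comul (R := k) c)) := by
  have h : TensorProduct.map (toCop k (C := C)).toLinearMap (toCop k (C := C)).toLinearMap =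
      (LinearMap.id : C ⊗[k] C →ₗ[k] C ⊗[k] C) := TensorProduct.map_id
  exact (LinearMap.congr_fun h _).symm

theorem counit_toCop (c : C) : counit (R := k) (toCop k c) = counit (R := k) c := rfl

end Cop

/-! ### Koppinen's smash product -/

section Koppinen

/-- Koppinen's smash product `#(C, A)`: the `k`-module `Hom(C, A)`, to be equipped with a
product that depends on the bialgebra `H`. -/
@[nolint unusedArguments]
def Koppinen (k _H C A : Type*) [CommRing k] [AddCommGroup C] [Module k C] [Ring A]
    [Algebra k A] : Type _ :=
  C →ₗ[k] A

variable (k : Type*) [CommRing k] (H : Type*) [Ring H] [Bialgebra k H]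
variable (C A : Type*) [AddCommGroup C] [Module k C] [Ring A] [Algebra k A]

instance : AddCommGroup (Koppinen k H C A) := inferInstanceAs (AddCommGroup (C →ₗ[k] A))
instance : Module k (Koppinen k H C A) := inferInstanceAs (Module k (C →ₗ[k] A))

/-- The underlying linear map of an element of `#(C, A)`. -/
def Koppinen.toHom : Koppinen k H C A ≃ₗ[k] (C →ₗ[k] A) := LinearEquiv.refl k _

variable [Coalgebra k C] [Module Hᵐᵒᵖ C] [IsScalarTower k Hᵐᵒᵖ C] [ComoduleAlgebra k H A]

variable {C A} in
/-- The map `c ↦ ∑ c₍₂₎ · f(c₍₁₎)₍₋₁₎ ⊗ f(c₍₁₎)₍₀₎`. -/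
def koppinenAux (f : C →ₗ[k] A) : C →ₗ[k] C ⊗[k] A :=
  lift (twist k H A C) ∘ₗ f.lTensor C ∘ₗ (TensorProduct.comm k C C).toLinearMap ∘ₗ comul

variable {C A} in
/-- The product `(f • g)(c) = ∑ f(c₍₁₎)₍₀₎ g(c₍₂₎ · f(c₍₁₎)₍₋₁₎)`. -/
def koppinenMul (f g : C →ₗ[k] A) : C →ₗ[k] A :=
  opMul k A ∘ₗ g.rTensor A ∘ₗ koppinenAux k H f

instance : Mul (Koppinen k H C A) where
  mul f g := (Koppinen.toHom k H C A).symm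
    (koppinenMul k H (Koppinen.toHom k H C A f) (Koppinen.toHom k H C A g))

instance : One (Koppinen k H C A) where
  one := (Koppinen.toHom k H C A).symm (Algebra.linearMap k A ∘ₗ counit)

theorem Koppinen.toHom_mul (f g : Koppinen k H C A) : Koppinen.toHom k H C A (f * g) =
    koppinenMul k H (Koppinen.toHom k H C A f) (Koppinen.toHom k H C A g) := rfl

variable {C A}

theorem koppinenMul_add_left (f f' g : C →ₗ[k] A) :
    koppinenMul k H (f + f') g = koppinenMul k H f g + koppinenMul k H f' g := by
  ext c
  simp [koppinenMul, koppinenAux, LinearMap.lTensor_add]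

theorem koppinenMul_add_right (f g g' : C →ₗ[k] A) :
    koppinenMul k H f (g + g') = koppinenMul k H f g + koppinenMul k H f g' := by
  ext c
  simp [koppinenMul, LinearMap.rTensor_add]

theorem koppinenMul_smul_left (x : k) (f g : C →ₗ[k] A) :
    koppinenMul k H (x • f) g = x • koppinenMul k H f g := by
  ext c
  simp [koppinenMul, koppinenAux, LinearMap.lTensor_smul]

theorem koppinenMul_smul_right (x : k) (f g : C →ₗ[k] A) :
    koppinenMul k H f (x • g) = x • koppinenMul k H f g := by
  ext c
  simp [koppinenMul, LinearMap.rTensor_smul]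

section Assoc

theorem twist_apply (d : C) (x : A) :
    twist k H A C d x = (ract k (A := H) d).rTensor A (coact k H x) := rfl

/-- An auxiliary trilinear expression, for associativity. -/
def assocAux (g : C →ₗ[k] A) (y : C ⊗[k] C) : (H ⊗[k] H) ⊗[k] A →ₗ[k] C ⊗[k] A :=
  (opMul k A).lTensor C ∘ₗ (TensorProduct.assoc k C A A).toLinearMap ∘ₗ
    (lift (twist k H A C) ∘ₗ g.lTensor C ∘ₗ (TensorProduct.comm k C C).toLinearMap ∘ₗ
      map₂ (ract k (A := H)) (ract k (A := H)) y).rTensor A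

theorem twist_koppinen (g : C →ₗ[k] A) (c d : C) (x : A) :
    twist k H A C d (opMul k A (g.rTensor A (twist k H A C c x))) =
      assocAux k H g (c ⊗ₜ d) ((comul (R := k)).rTensor A (coact k H x)) := by
  let L : H ⊗[k] (H ⊗[k] A) →ₗ[k] C ⊗[k] A :=
    lift (((LinearMap.mul k (H ⊗[k] A)).flip.compr₂ ((ract k (A := H) d).rTensor A)) ∘ₗ
      (coact k H ∘ₗ g ∘ₗ ract k (A := H) c))
  have h1 : ∀ w : H ⊗[k] A, twist k H A C d (opMul k A (g.rTensor A
      ((ract k (A := H) c).rTensor A w))) = L ((coact k H).lTensor H w) := by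
    intro w
    induction w with
    | zero => simp
    | add x y hx hy => simp only [map_add, hx, hy]
    | tmul h b =>
      simp only [LinearMap.rTensor_tmul, opMul_tmul, LinearMap.lTensor_tmul, twist_apply, L,
        lift.tmul, LinearMap.comp_apply, LinearMap.compr₂_apply, LinearMap.flip_apply,
        LinearMap.mul_apply']
      congr 1
      exact ComoduleAlgebra.coact_mul _ _
  have h2 : ∀ w : (H ⊗[k] H) ⊗[k] A,
      L (TensorProduct.assoc k H H A w) = assocAux k H g (c ⊗ₜ d) w := by
    intro w
    induction w with
    | zero => simp
    | add x y hx hy => simp only [map_add, hx, hy]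
    | tmul hh b =>
      induction hh with
      | zero => simp
      | add x y hx hy => simp only [map_add, add_tmul, hx, hy]
      | tmul h h' =>
        simp only [TensorProduct.assoc_tmul, L, lift.tmul, LinearMap.comp_apply,
          LinearMap.compr₂_apply, LinearMap.flip_apply, LinearMap.mul_apply', assocAux,
          LinearMap.rTensor_tmul, map₂_apply_tmul, LinearEquiv.coe_coe, ract_apply,
          TensorProduct.map_tmul, TensorProduct.comm_tmul, LinearMap.lTensor_tmul,
          twist_apply]
        induction coact k H (g (op h • c)) with
        | zero => simp
        | add x y hx hy => simp only [map_add, mul_add, add_tmul, hx, hy]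
        | tmul u v => simp [mul_smul]
  rw [twist_apply k H c x, h1, ← h2]
  congr 1
  exact (LeftComodule.coassoc x).symm

variable [ModuleCoalgebra k H C]

theorem koppinenAux_twist (g : C →ₗ[k] A) (c : C) (x : A) :
    (opMul k A).lTensor C (TensorProduct.assoc k C A A
      ((koppinenAux k H g).rTensor A (twist k H A C c x))) =
      assocAux k H g (comul (R := k) c) ((comul (R := k)).rTensor A (coact k H x)) := by
  rw [twist_apply]
  induction coact k H x with
  | zero => simp
  | add x y hx hy => simp only [map_add, hx, hy]
  | tmul h b =>
    simp [assocAux, koppinenAux, ModuleCoalgebra.comul_act]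

theorem koppinenAux_mul (f g : C →ₗ[k] A) (c : C) :
    koppinenAux k H (koppinenMul k H f g) c =
      (opMul k A).lTensor C (TensorProduct.assoc k C A A
        ((koppinenAux k H g).rTensor A (koppinenAux k H f c))) := by
  let B : C →ₗ[k] C ⊗[k] C →ₗ[k] C ⊗[k] A :=
    LinearMap.mk₂ k (fun c y => assocAux k H g y ((comul (R := k)).rTensor A (coact k H (f c))))
      (by simp) (by simp)
      (by simp [assocAux, LinearMap.rTensor_add, LinearMap.comp_add])
      (by simp [assocAux, LinearMap.rTensor_smul, LinearMap.comp_smul])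
  have hB : ∀ c y, B c y = assocAux k H g y ((comul (R := k)).rTensor A (coact k H (f c))) :=
    fun _ _ => rfl
  clear_value B
  have h1 : ∀ w : C ⊗[k] C, lift (twist k H A C) ((koppinenMul k H f g).lTensor C
      (TensorProduct.comm k C C w)) =
      lift B (TensorProduct.assoc k C C C ((comul (R := k)).rTensor C w)) := by
    intro w
    induction w with
    | zero => simp
    | add x y hx hy => simp only [map_add, hx, hy]
    | tmul a d =>
      simp only [TensorProduct.comm_tmul, LinearMap.lTensor_tmul, lift.tmul, koppinenMul,
        LinearMap.comp_apply, LinearMap.rTensor_tmul, koppinenAux, LinearEquiv.coe_coe]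
      induction comul (R := k) a with
      | zero => simp
      | add x y hx hy => simp only [map_add, add_tmul, hx, hy]
      | tmul a c =>
        simpa [hB] using twist_koppinen k H g c d (f a)
  have h2 : ∀ w : C ⊗[k] C, (opMul k A).lTensor C (TensorProduct.assoc k C A A
      ((koppinenAux k H g).rTensor A (lift (twist k H A C) (f.lTensor C
        (TensorProduct.comm k C C w))))) = lift B ((comul (R := k)).lTensor C w) := by
    intro w
    induction w with
    | zero => simp
    | add x y hx hy => simp only [map_add, hx, hy]
    | tmul a d =>
      simpa [hB] using koppinenAux_twist k H g d (f a)
  have h3 := h2 (comul (R := k) c)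
  rw [← coassoc_apply, ← h1] at h3
  exact h3.symm

theorem koppinenMul_assoc (f g e : C →ₗ[k] A) :
    koppinenMul k H (koppinenMul k H f g) e = koppinenMul k H f (koppinenMul k H g e) := by
  ext c
  rw [koppinenMul, LinearMap.comp_apply, LinearMap.comp_apply, koppinenAux_mul,
    koppinenMul.eq_1 k H f, LinearMap.comp_apply, LinearMap.comp_apply]
  induction koppinenAux k H f c with
  | zero => simp
  | add x y hx hy => simp only [map_add, hx, hy]
  | tmul c a =>
    simp only [LinearMap.rTensor_tmul, koppinenMul, LinearMap.comp_apply, opMul_tmul]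
    induction koppinenAux k H g c with
    | zero => simp
    | add x y hx hy => simp only [map_add, add_tmul, mul_add, hx, hy]
    | tmul c b => simp [mul_assoc]

theorem koppinenMul_one_left (g : C →ₗ[k] A) :
    koppinenMul k H (Algebra.linearMap k A ∘ₗ counit) g = g := by
  have h1 : ∀ d : C, twist k H A C d 1 = d ⊗ₜ 1 := by
    intro d
    rw [twist_apply, show coact k H (1 : A) = 1 from ComoduleAlgebra.coact_one,
      Algebra.TensorProduct.one_def]
    simp
  ext c
  have h2 : ∀ w : C ⊗[k] C, lift (twist k H A C)
      ((Algebra.linearMap k A ∘ₗ counit (A := C)).lTensor C (TensorProduct.comm k C C w)) =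
      (TensorProduct.lid k C ((counit (R := k)).rTensor C w)) ⊗ₜ 1 := by
    intro w
    induction w with
    | zero => simp
    | add x y hx hy => simp only [map_add, add_tmul, hx, hy]
    | tmul a d => simp [Algebra.algebraMap_eq_smul_one, h1, smul_tmul']
  simp [koppinenMul, koppinenAux, h2]

theorem koppinenMul_one_right (f : C →ₗ[k] A) :
    koppinenMul k H f (Algebra.linearMap k A ∘ₗ counit) = f := by
  have h1 : ∀ (d : C) (x : A), opMul k A ((Algebra.linearMap k A ∘ₗ counit).rTensor A
      (twist k H A C d x)) = counit (R := k) d • x := by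
    intro d x
    have h2 : TensorProduct.lid k A ((counit (R := k)).rTensor A (coact k H x)) = x :=
      LeftComodule.counit_coact x
    rw [twist_apply]
    conv_rhs => rw [← h2]
    induction coact k H x with
    | zero => simp
    | add x y hx hy => simp only [map_add, smul_add, hx, hy]
    | tmul h b =>
      simp [ModuleCoalgebra.counit_act, Algebra.algebraMap_eq_smul_one, mul_smul]
  ext c
  have h2 : ∀ w : C ⊗[k] C, opMul k A ((Algebra.linearMap k A ∘ₗ counit).rTensor A
      (lift (twist k H A C) (f.lTensor C (TensorProduct.comm k C C w)))) =
      f (TensorProduct.rid k C ((counit (R := k)).lTensor C w)) := by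
    intro w
    induction w with
    | zero => simp
    | add x y hx hy => simp only [map_add, hx, hy]
    | tmul a d => simp [h1]
  simpa [koppinenMul, koppinenAux] using h2 (comul (R := k) c)

variable (C A)

instance : Ring (Koppinen k H C A) where
  __ := (inferInstance : AddCommGroup (Koppinen k H C A))
  left_distrib f g e := koppinenMul_add_right k H _ _ _
  right_distrib f g e := koppinenMul_add_left k H _ _ _
  zero_mul f := by
    have := koppinenMul_smul_left k H (0 : k) 0 (Koppinen.toHom k H C A f)
    rw [zero_smul, zero_smul] at this
    exact this
  mul_zero f := by
    have := koppinenMul_smul_right k H (0 : k) (Koppinen.toHom k H C A f) 0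
    rw [zero_smul, zero_smul] at this
    exact this
  mul_assoc f g e := koppinenMul_assoc k H _ _ _
  one_mul f := koppinenMul_one_left k H _
  mul_one f := koppinenMul_one_right k H _

instance : Algebra k (Koppinen k H C A) :=
  Algebra.ofModule (fun x _ _ => koppinenMul_smul_left k H x _ _)
    (fun x _ _ => koppinenMul_smul_right k H x _ _)

end Assoc

end Koppinen

/-! ### The right `H`-module coalgebra `C^cop ⊗ C` -/

section CopTensor

variable (k : Type*) [CommRing k] (H : Type*) [Ring H] [Bialgebra k H]
variable (C : Type*) [AddCommGroup C] [Module k C] [Module Hᵐᵒᵖ C] [IsScalarTower k Hᵐᵒᵖ C]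

/-- The action `(c ⊗ d) · h = c ⊗ d · h`. -/
def copAct : Cop C ⊗[k] C →ₗ[k] H →ₗ[k] Cop C ⊗[k] C :=
  (LinearMap.lTensorHom (Cop C) ∘ₗ (ract k (A := H) (M := C)).flip).flip

variable {C} in
@[simp] theorem copAct_tmul (c : Cop C) (d : C) (h : H) :
    copAct k H C (c ⊗ₜ d) h = c ⊗ₜ (op h • d) := rfl

instance copTensorModule : Module Hᵐᵒᵖ (Cop C ⊗[k] C) :=
  rightModuleOfAct k (copAct k H C)
    (fun m => by
      induction m with
      | zero => simp
      | add x y hx hy => simp only [map_add, LinearMap.add_apply, hx, hy]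
      | tmul c d => simp)
    (fun m a b => by
      induction m with
      | zero => simp
      | add x y hx hy => simp only [map_add, LinearMap.add_apply, hx, hy]
      | tmul c d => simp [mul_smul])

theorem copTensor_smul (h : H) (m : Cop C ⊗[k] C) : op h • m = copAct k H C m h := rfl

instance : IsScalarTower k Hᵐᵒᵖ (Cop C ⊗[k] C) where
  smul_assoc x a m := by
    change copAct k H C m (x • unop a) = x • copAct k H C m (unop a)
    simp

variable [Coalgebra k C] [ModuleCoalgebra k H C]

instance : ModuleCoalgebra k H (Cop C ⊗[k] C) where
  comul_act m h := by
    induction m with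
    | zero => simp
    | add x y hx hy => simp only [smul_add, map_add, LinearMap.add_apply, hx, hy]
    | tmul c d =>
      rw [copTensor_smul, copAct_tmul, TensorProduct.comul_tmul, TensorProduct.comul_tmul,
        ModuleCoalgebra.comul_act]
      induction comul (R := k) c with
      | zero => simp
      | add x y hx hy => simp only [map_add, add_tmul, LinearMap.add_apply, hx, hy]
      | tmul c c' =>
        induction comul (R := k) d with
        | zero => simp
        | add x y hx hy => simp only [map_add, tmul_add, LinearMap.add_apply, hx, hy]
        | tmul d d' =>
          induction comul (R := k) h with
          | zero => simp
          | add x y hx hy => simp only [map_add, tmul_add, hx, hy]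
          | tmul h h' => simp [map₂_apply_tmul, copTensor_smul]
  counit_act m h := by
    induction m with
    | zero => simp
    | add x y hx hy => simp only [smul_add, map_add, add_mul, hx, hy]
    | tmul c d =>
      rw [copTensor_smul]
      simp only [TensorProduct.counit_tmul, copAct_tmul, ModuleCoalgebra.counit_act, smul_eq_mul]
      ring

end CopTensor

/-! ### The categories of right `A`-modules and of Doi-Hopf modules -/

section Categories

variable (k : Type*) [CommRing k] (H : Type*) [Ring H] [Bialgebra k H]
variable (A : Type u) [Ring A] [Algebra k A] [ComoduleAlgebra k H A]
variable (C : Type u) [AddCommGroup C] [Module k C] [Coalgebra k C] [Module Hᵐᵒᵖ C]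
  [IsScalarTower k Hᵐᵒᵖ C]

/-- Right modules over the `k`-algebra `A`. -/
structure RightMod where
  /-- the underlying type -/
  carrier : Type u
  [addCommGroup : AddCommGroup carrier]
  [module : Module k carrier]
  [rightModule : Module Aᵐᵒᵖ carrier]
  [isScalarTower : IsScalarTower k Aᵐᵒᵖ carrier]

attribute [instance] RightMod.addCommGroup RightMod.module RightMod.rightModule
  RightMod.isScalarTower

/-- The right `A`-linear maps. -/
def RightMod.homs {k A} [CommRing k] [Ring A] [Algebra k A] (M N : RightMod.{u} k A) :
    Submodule k (M.carrier →ₗ[k] N.carrier) where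
  carrier := {f | ∀ (a : A) (m : M.carrier), f (op a • m) = op a • f m}
  zero_mem' := by simp
  add_mem' hf hg a m := by simp [hf a m, hg a m]
  smul_mem' x f hf a m := by
    rw [LinearMap.smul_apply, hf a m, LinearMap.smul_apply]
    exact ((LinearMap.map_smul₂ (ract k (A := A)) x (f m) a)).symm

instance : Category (RightMod.{u} k A) where
  Hom M N := RightMod.homs M N
  id M := ⟨LinearMap.id, fun _ _ => rfl⟩
  comp f g := ⟨g.1 ∘ₗ f.1, fun a m => by simp [f.2 a m, g.2 a _]⟩

/-- Right-left Doi-Hopf modules: right `A`-modules and left `C`-comodules `M` with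
`ρ(m a) = ∑ m₍₋₁₎ · a₍₋₁₎ ⊗ m₍₀₎ a₍₀₎`. -/
structure DoiHopfMod extends RightMod.{u} k A where
  [comodule : LeftComodule k C carrier]
  coact_act : ∀ (m : carrier) (a : A), coact k C (op a • m) =
    map₂ (ract k (A := H)) (ract k (A := A)) (coact k C m) (coact k H a)

attribute [instance] DoiHopfMod.comodule

variable {k H A C} in
/-- The right `A`-linear, left `C`-colinear maps. -/
def DoiHopfMod.homs (M N : DoiHopfMod.{u} k H A C) :
    Submodule k (M.carrier →ₗ[k] N.carrier) where
  carrier := {f | f ∈ RightMod.homs M.toRightMod N.toRightMod ∧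
    ∀ m : M.carrier, coact k C (f m) = f.lTensor C (coact k C m)}
  zero_mem' := ⟨Submodule.zero_mem _, by simp⟩
  add_mem' hf hg := ⟨Submodule.add_mem _ hf.1 hg.1, fun m => by
    simp [hf.2 m, hg.2 m, LinearMap.lTensor_add]⟩
  smul_mem' x f hf := ⟨Submodule.smul_mem _ x hf.1, fun m => by
    simp [hf.2 m, LinearMap.lTensor_smul]⟩

instance : Category (DoiHopfMod.{u} k H A C) where
  Hom M N := DoiHopfMod.homs M N
  id M := ⟨LinearMap.id, fun _ _ => rfl, fun _ => by simp⟩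
  comp f g := ⟨g.1 ∘ₗ f.1, fun a m => by simp [f.2.1 a m, g.2.1 a _], fun m => by
    simp [f.2.2 m, g.2.2 _, LinearMap.lTensor_comp]⟩

variable {k H A C} in
/-- The underlying `k`-linear map of a morphism of Doi-Hopf modules. -/
def DoiHopfMod.toLin {M N : DoiHopfMod.{u} k H A C} (f : M ⟶ N) : M.carrier →ₗ[k] N.carrier :=
  f.1

theorem DoiHopfMod.hom_ext {M N : DoiHopfMod.{u} k H A C} {f g : M ⟶ N}
    (h : DoiHopfMod.toLin f = DoiHopfMod.toLin g) : f = g := Subtype.ext h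

instance : Preadditive (DoiHopfMod.{u} k H A C) where
  homGroup M N := inferInstanceAs (AddCommGroup (DoiHopfMod.homs M N))
  add_comp _ _ _ f f' g := by
    apply DoiHopfMod.hom_ext
    exact LinearMap.comp_add _ _ _
  comp_add _ _ _ f g g' := by
    apply DoiHopfMod.hom_ext
    exact LinearMap.add_comp _ _ _

instance : Linear k (DoiHopfMod.{u} k H A C) where
  homModule M N := inferInstanceAs (Module k (DoiHopfMod.homs M N))
  smul_comp _ _ _ x f g := by
    apply DoiHopfMod.hom_ext
    exact LinearMap.comp_smul _ _ _
  comp_smul _ _ _ f x g := by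
    apply DoiHopfMod.hom_ext
    exact LinearMap.smul_comp _ _ _

/-- The functor forgetting the `C`-coaction. -/
def forgetCoaction : DoiHopfMod.{u} k H A C ⥤ RightMod.{u} k A where
  obj M := M.toRightMod
  map f := ⟨f.1, f.2.1⟩

section Cofree

variable {A}

/-- The action `(c ⊗ n) · a = ∑ c · a₍₋₁₎ ⊗ n a₍₀₎` on `C ⊗ N`. -/
def cofreeAct (N : RightMod.{u} k A) :
    C ⊗[k] N.carrier →ₗ[k] A →ₗ[k] C ⊗[k] N.carrier :=
  (map₂ (ract k (A := H)) (ract k (A := A))).compl₂ (coact k H)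

theorem cofreeAct_one (N : RightMod.{u} k A) (z : C ⊗[k] N.carrier) :
    cofreeAct k H C N z 1 = z := by
  have h : coact k H (1 : A) = 1 ⊗ₜ 1 := ComoduleAlgebra.coact_one
  rw [cofreeAct, LinearMap.compl₂_apply, h]
  induction z with
  | zero => simp
  | add x y hx hy => simp only [map_add, LinearMap.add_apply, hx, hy]
  | tmul c n => simp [map₂_apply_tmul]

theorem cofreeAct_mul (N : RightMod.{u} k A) (z : C ⊗[k] N.carrier) (a b : A) :
    cofreeAct k H C N z (a * b) = cofreeAct k H C N (cofreeAct k H C N z a) b := by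
  have h : coact k H (a * b) = coact k H a * coact k H b := ComoduleAlgebra.coact_mul a b
  simp only [cofreeAct, LinearMap.compl₂_apply, h]
  induction z with
  | zero => simp
  | add x y hx hy => simp only [map_add, LinearMap.add_apply, hx, hy]
  | tmul c n =>
    induction coact k H a with
    | zero => simp
    | add x y hx hy => simp only [map_add, add_mul, LinearMap.add_apply, hx, hy]
    | tmul g a =>
      induction coact k H b with
      | zero => simp
      | add x y hx hy => simp only [map_add, mul_add, hx, hy]
      | tmul h b => simp [map₂_apply_tmul, mul_smul]

/-- `C ⊗ N` as a right `A`-module. -/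
def cofreeRightMod (N : RightMod.{u} k A) : RightMod.{u} k A :=
  letI : Module Aᵐᵒᵖ (C ⊗[k] N.carrier) := rightModuleOfAct k (cofreeAct k H C N)
    (cofreeAct_one k H C N) (cofreeAct_mul k H C N)
  haveI : IsScalarTower k Aᵐᵒᵖ (C ⊗[k] N.carrier) := ⟨fun x a m => by
    change cofreeAct k H C N m (x • unop a) = x • cofreeAct k H C N m (unop a)
    simp⟩
  { carrier := C ⊗[k] N.carrier }

/-- The comodule `C ⊗ N`, with coaction `c ⊗ n ↦ ∑ c₍₁₎ ⊗ c₍₂₎ ⊗ n`. -/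
@[reducible] def cofreeComodule (N : Type*) [AddCommGroup N] [Module k N] :
    LeftComodule k C (C ⊗[k] N) where
  coact := (TensorProduct.assoc k C C N).toLinearMap ∘ₗ (comul (R := k)).rTensor N
  coassoc z := by
    induction z with
    | zero => simp
    | add x y hx hy => simp only [map_add, hx, hy]
    | tmul c n =>
      let X : C ⊗[k] (C ⊗[k] C) →ₗ[k] C ⊗[k] (C ⊗[k] (C ⊗[k] N)) :=
        (((TensorProduct.mk k C N).flip n).lTensor C).lTensor C
      have h1 : ∀ w : C ⊗[k] C, TensorProduct.assoc k C C (C ⊗[k] N)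
          ((comul (R := k)).rTensor (C ⊗[k] N) (TensorProduct.assoc k C C N (w ⊗ₜ n))) =
          X (TensorProduct.assoc k C C C ((comul (R := k)).rTensor C w)) := by
        intro w
        induction w with
        | zero => simp
        | add x y hx hy => simp only [map_add, add_tmul, hx, hy]
        | tmul a b =>
          simp only [TensorProduct.assoc_tmul, LinearMap.rTensor_tmul]
          induction comul (R := k) a with
          | zero => simp
          | add x y hx hy => simp only [map_add, add_tmul, hx, hy]
          | tmul a a' => simp [X]
      have h2 : ∀ w : C ⊗[k] C,
          ((TensorProduct.assoc k C C N).toLinearMap ∘ₗ (comul (R := k)).rTensor N).lTensor C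
            (TensorProduct.assoc k C C N (w ⊗ₜ n)) = X ((comul (R := k)).lTensor C w) := by
        intro w
        induction w with
        | zero => simp
        | add x y hx hy => simp only [map_add, add_tmul, hx, hy]
        | tmul a b =>
          simp only [TensorProduct.assoc_tmul, LinearMap.lTensor_tmul, LinearMap.comp_apply,
            LinearEquiv.coe_coe, LinearMap.rTensor_tmul]
          induction comul (R := k) b with
          | zero => simp
          | add x y hx hy => simp only [map_add, add_tmul, tmul_add, hx, hy]
          | tmul b b' => simp [X]
      simp only [LinearMap.comp_apply, LinearEquiv.coe_coe, LinearMap.rTensor_tmul, h1]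
      rw [h2, coassoc_apply]
  counit_coact z := by
    induction z with
    | zero => simp
    | add x y hx hy => simp only [map_add, hx, hy]
    | tmul c n =>
      have h1 : ∀ w : C ⊗[k] C, TensorProduct.lid k (C ⊗[k] N)
          ((counit (R := k)).rTensor (C ⊗[k] N) (TensorProduct.assoc k C C N (w ⊗ₜ n))) =
          TensorProduct.lid k C ((counit (R := k)).rTensor C w) ⊗ₜ n := by
        intro w
        induction w with
        | zero => simp
        | add x y hx hy => simp only [map_add, add_tmul, hx, hy]
        | tmul a b => simp [smul_tmul']
      simp [h1]

variable [ModuleCoalgebra k H C]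

theorem cofree_coact_act (N : RightMod.{u} k A) (z : C ⊗[k] N.carrier) (a : A) :
    TensorProduct.assoc k C C N.carrier
      ((comul (R := k)).rTensor N.carrier (cofreeAct k H C N z a)) =
    map₂ (ract k (A := H)) (cofreeAct k H C N) (TensorProduct.assoc k C C N.carrier
      ((comul (R := k)).rTensor N.carrier z)) (coact k H a) := by
  induction z with
  | zero => simp
  | add x y hx hy => simp only [map_add, LinearMap.add_apply, hx, hy]
  | tmul c n =>
    let K : C ⊗[k] C →ₗ[k] H ⊗[k] (H ⊗[k] A) →ₗ[k] C ⊗[k] (C ⊗[k] N.carrier) :=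
      map₂ (ract k (A := H)) (map₂ (ract k (A := H)) (ract k (A := A))) ∘ₗ
        ((TensorProduct.mk k C N.carrier).flip n).lTensor C
    have h1 : ∀ w : H ⊗[k] A, TensorProduct.assoc k C C N.carrier
        ((comul (R := k)).rTensor N.carrier
          (map₂ (ract k (A := H)) (ract k (A := A)) (c ⊗ₜ n) w)) =
        K (comul (R := k) c) (TensorProduct.assoc k H H A ((comul (R := k)).rTensor A w)) := by
      intro w
      induction w with
      | zero => simp
      | add x y hx hy => simp only [map_add, hx, hy]
      | tmul h b =>
        simp only [map₂_apply_tmul, TensorProduct.map_tmul, ract_apply, LinearMap.rTensor_tmul,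
          ModuleCoalgebra.comul_act]
        induction comul (R := k) h with
        | zero => simp
        | add x y hx hy => simp only [map_add, add_tmul, hx, hy]
        | tmul h h' =>
          induction comul (R := k) c with
          | zero => simp
          | add x y hx hy => simp only [map_add, add_tmul, LinearMap.add_apply, hx, hy]
          | tmul c c' => simp [K, map₂_apply_tmul]
    have h2 : ∀ w : H ⊗[k] A, map₂ (ract k (A := H)) (cofreeAct k H C N)
        (TensorProduct.assoc k C C N.carrier (comul (R := k) c ⊗ₜ n)) w =
        K (comul (R := k) c) ((coact k H).lTensor H w) := by
      intro w
      induction comul (R := k) c with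
      | zero => simp
      | add x y hx hy => simp only [map_add, add_tmul, LinearMap.add_apply, hx, hy]
      | tmul c c' =>
        induction w with
        | zero => simp
        | add x y hx hy => simp only [map_add, hx, hy]
        | tmul h b => simp [K, map₂_apply_tmul, cofreeAct]
    have h3 : TensorProduct.assoc k H H A ((comul (R := k)).rTensor A (coact k H a)) =
        (coact k H).lTensor H (coact k H a) := LeftComodule.coassoc a
    rw [LinearMap.rTensor_tmul, h2, ← h3, ← h1]
    rfl

theorem cofreeAct_map {N N' : RightMod.{u} k A} (f : N ⟶ N') (z : C ⊗[k] N.carrier) (a : A) :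
    f.1.lTensor C (cofreeAct k H C N z a) = cofreeAct k H C N' (f.1.lTensor C z) a := by
  simp only [cofreeAct, LinearMap.compl₂_apply]
  induction coact k H a with
  | zero => simp
  | add x y hx hy => simp only [map_add, hx, hy]
  | tmul h b =>
    induction z with
    | zero => simp
    | add x y hx hy => simp only [map_add, LinearMap.add_apply, hx, hy]
    | tmul c n =>
      have := f.2 b n
      simp [map₂_apply_tmul, this]

theorem cofreeComodule_map {N N' : Type*} [AddCommGroup N] [Module k N] [AddCommGroup N']
    [Module k N'] (f : N →ₗ[k] N') (z : C ⊗[k] N) :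
    TensorProduct.assoc k C C N' ((comul (R := k)).rTensor N' (f.lTensor C z)) =
      (f.lTensor C).lTensor C (TensorProduct.assoc k C C N ((comul (R := k)).rTensor N z)) := by
  induction z with
  | zero => simp
  | add x y hx hy => simp only [map_add, hx, hy]
  | tmul c n =>
    simp only [LinearMap.lTensor_tmul, LinearMap.rTensor_tmul]
    induction comul (R := k) c with
    | zero => simp
    | add x y hx hy => simp only [map_add, add_tmul, hx, hy]
    | tmul c c' => simp

theorem counit_cofreeAct (N : RightMod.{u} k A) (z : C ⊗[k] N.carrier) (a : A) :
    TensorProduct.lid k N.carrier ((counit (R := k)).rTensor N.carrier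
      (cofreeAct k H C N z a)) =
    op a • TensorProduct.lid k N.carrier ((counit (R := k)).rTensor N.carrier z) := by
  have h : TensorProduct.lid k A ((counit (R := k)).rTensor A (coact k H a)) = a :=
    LeftComodule.counit_coact a
  conv_rhs => rw [← h]
  simp only [cofreeAct, LinearMap.compl₂_apply]
  induction z with
  | zero => simp
  | add x y hx hy => simp only [map_add, LinearMap.add_apply, smul_add, hx, hy]
  | tmul c n =>
    induction coact k H a with
    | zero => simp
    | add x y hx hy => simp only [map_add, MulOpposite.op_add, add_smul, hx, hy]
    | tmul h b =>
      have h2 : op b • (counit (R := k) c • n) = counit (R := k) c • (op b • n) :=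
        LinearMap.map_smul₂ (ract k (A := A)) (counit (R := k) c) n b
      simp [map₂_apply_tmul, ModuleCoalgebra.counit_act, mul_smul, smul_assoc, h2,
        smul_comm (counit (R := k) c) (counit (R := k) h)]

theorem counit_coact_cofree (N : Type*) [AddCommGroup N] [Module k N] :
    ((TensorProduct.lid k N).toLinearMap ∘ₗ (counit (R := k)).rTensor N).lTensor C ∘ₗ
      (TensorProduct.assoc k C C N).toLinearMap ∘ₗ (comul (R := k)).rTensor N =
    LinearMap.id := by
  apply TensorProduct.ext'
  intro c n
  have h1 : ∀ w : C ⊗[k] C, ((TensorProduct.lid k N).toLinearMap ∘ₗ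
      (counit (R := k)).rTensor N).lTensor C (TensorProduct.assoc k C C N (w ⊗ₜ n)) =
      TensorProduct.rid k C ((counit (R := k)).lTensor C w) ⊗ₜ n := by
    intro w
    induction w with
    | zero => simp
    | add x y hx hy => simp only [map_add, add_tmul, hx, hy]
    | tmul a b => simp [smul_tmul]
  simp [h1]

/-- The Doi-Hopf module `C ⊗ N`. -/
def cofreeObj (N : RightMod.{u} k A) : DoiHopfMod.{u} k H A C where
  toRightMod := cofreeRightMod k H C N
  comodule := cofreeComodule k C N.carrier
  coact_act z a := cofree_coact_act k H C N z a

variable (A)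

/-- The functor `N ↦ C ⊗ N`, right adjoint to the functor forgetting the coaction. -/
def cofree : RightMod.{u} k A ⥤ DoiHopfMod.{u} k H A C where
  obj N := cofreeObj k H C N
  map {N N'} f := ⟨f.1.lTensor C, fun a z => cofreeAct_map k H C f z a,
    fun z => cofreeComodule_map k C f.1 z⟩
  map_id N := by
    apply DoiHopfMod.hom_ext
    exact LinearMap.lTensor_id _ _
  map_comp f g := by
    apply DoiHopfMod.hom_ext
    exact LinearMap.lTensor_comp _ _ _

/-- The natural transformation `1 → GF` given by the coactions `M → C ⊗ M`. -/
def unitCoaction : 𝟭 (DoiHopfMod.{u} k H A C) ⟶ forgetCoaction k H A C ⋙ cofree k H A C where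
  app M := ⟨coact k C (M := M.carrier), fun a m => M.coact_act m a, fun m =>
    (LeftComodule.coassoc (k := k) (C := C) m)⟩
  naturality M N f := by
    apply DoiHopfMod.hom_ext
    ext m
    exact f.2.2 m

/-- The natural transformation `FG → 1`, `c ⊗ n ↦ ε(c) n`. -/
def counitCoaction : cofree k H A C ⋙ forgetCoaction k H A C ⟶ 𝟭 (RightMod.{u} k A) where
  app N := ⟨(TensorProduct.lid k N.carrier).toLinearMap ∘ₗ (counit (R := k)).rTensor N.carrier,
    fun a z => counit_cofreeAct k H C N z a⟩
  naturality M N f := by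
    apply Subtype.ext
    refine TensorProduct.ext' fun c n => ?_
    change TensorProduct.lid k N.carrier ((counit (R := k)).rTensor N.carrier
      (f.1.lTensor C (c ⊗ₜ n))) = f.1 (TensorProduct.lid k M.carrier
        ((counit (R := k)).rTensor M.carrier (c ⊗ₜ n)))
    simp

/-- The functor forgetting the coaction is left adjoint to `N ↦ C ⊗ N`. -/
def coactionAdjunction : forgetCoaction k H A C ⊣ cofree k H A C :=
  Adjunction.mkOfUnitCounit
    { unit := unitCoaction k H A C
      counit := counitCoaction k H A C
      left_triangle := by
        ext M
        apply Subtype.ext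
        ext m
        exact LeftComodule.counit_coact (k := k) (C := C) (M := M.carrier) m
      right_triangle := by
        ext N
        apply DoiHopfMod.hom_ext
        exact counit_coact_cofree k C N.carrier }

end Cofree

end Categories
/-! ### The algebra `V` of natural transformations `GF → 1` -/

section NatTransAlgebra

variable (k : Type*) [CommRing k] (H : Type*) [Ring H] [Bialgebra k H]
variable (A : Type u) [Ring A] [Algebra k A] [ComoduleAlgebra k H A]
variable (C : Type u) [AddCommGroup C] [Module k C] [Coalgebra k C] [Module Hᵐᵒᵖ C]
  [IsScalarTower k Hᵐᵒᵖ C] [ModuleCoalgebra k H C]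

/-- The natural transformations `GF → 1`, where `F` forgets the coaction and `G` is its right
adjoint `C ⊗ -`. -/
def V : Type _ := forgetCoaction k H A C ⋙ cofree k H A C ⟶ 𝟭 (DoiHopfMod.{u} k H A C)

variable {k H A C}

/-- An element of `V` as a natural transformation. -/
def V.toNatTrans (ν : V k H A C) :
    forgetCoaction k H A C ⋙ cofree k H A C ⟶ 𝟭 (DoiHopfMod.{u} k H A C) := ν

/-- The component `ν_M : C ⊗ M → M`. -/
def V.app (ν : V k H A C) (M : DoiHopfMod.{u} k H A C) : C ⊗[k] M.carrier →ₗ[k] M.carrier :=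
  DoiHopfMod.toLin (ν.toNatTrans.app M)

variable (k H A C)

instance : AddCommGroup (V k H A C) :=
  inferInstanceAs (AddCommGroup (forgetCoaction k H A C ⋙ cofree k H A C ⟶ 𝟭 _))

instance : Module k (V k H A C) :=
  inferInstanceAs (Module k (forgetCoaction k H A C ⋙ cofree k H A C ⟶ 𝟭 _))

/-- The product `ν • ν' = ν' ∘ ρ ∘ ν`. -/
instance : Mul (V k H A C) where
  mul ν ν' := (ν.toNatTrans ≫ unitCoaction k H A C ≫ ν'.toNatTrans :
    forgetCoaction k H A C ⋙ cofree k H A C ⟶ 𝟭 _)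

/-- The addition and scalar multiplication are pointwise. -/
theorem V.app_smul_add (ν ν' : V k H A C) (x : k) (M : DoiHopfMod.{u} k H A C) :
    (x • ν + ν').app M = x • ν.app M + ν'.app M := rfl

instance : NonUnitalRing (V k H A C) where
  left_distrib ν ν' ν'' := by
    change (ν.toNatTrans ≫ unitCoaction k H A C ≫ (ν'.toNatTrans + ν''.toNatTrans)) =
      ν.toNatTrans ≫ unitCoaction k H A C ≫ ν'.toNatTrans +
        ν.toNatTrans ≫ unitCoaction k H A C ≫ ν''.toNatTrans
    rw [Preadditive.comp_add, Preadditive.comp_add]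
  right_distrib ν ν' ν'' := by
    exact Preadditive.add_comp _ _ _ ν.toNatTrans ν'.toNatTrans
      (unitCoaction k H A C ≫ ν''.toNatTrans)
  zero_mul ν := Limits.zero_comp
  mul_zero ν := by
    change ν.toNatTrans ≫ unitCoaction k H A C ≫ 0 = 0
    rw [Limits.comp_zero, Limits.comp_zero]
  mul_assoc ν ν' ν'' := by
    change (ν.toNatTrans ≫ unitCoaction k H A C ≫ ν'.toNatTrans) ≫
      unitCoaction k H A C ≫ ν''.toNatTrans = ν.toNatTrans ≫ unitCoaction k H A C ≫
        ν'.toNatTrans ≫ unitCoaction k H A C ≫ ν''.toNatTrans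
    simp only [Category.assoc]

instance : IsScalarTower k (V k H A C) (V k H A C) where
  smul_assoc x ν ν' := Linear.smul_comp (R := k) _ _ _ x ν.toNatTrans
    (unitCoaction k H A C ≫ ν'.toNatTrans)

instance : SMulCommClass k (V k H A C) (V k H A C) where
  smul_comm x ν ν' := by
    change x • (ν.toNatTrans ≫ unitCoaction k H A C ≫ ν'.toNatTrans) =
      ν.toNatTrans ≫ unitCoaction k H A C ≫ (x • ν'.toNatTrans)
    rw [Linear.comp_smul, Linear.comp_smul]

variable {k H A C} in
/-- `ν` is a splitting of `ρ : 1 → GF`. -/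
def V.IsSplitting (ν : V k H A C) : Prop := unitCoaction k H A C ≫ ν.toNatTrans = 𝟙 _

end NatTransAlgebra

/-! ### The modules `V₃` and `V₄` -/

section Integrals

variable (k : Type*) [CommRing k] (H : Type*) [Ring H] [Bialgebra k H]
variable (A : Type*) [Ring A] [Algebra k A] [ComoduleAlgebra k H A]
variable (C : Type*) [AddCommGroup C] [Module k C] [Coalgebra k C] [Module Hᵐᵒᵖ C]
  [IsScalarTower k Hᵐᵒᵖ C]

variable {A C} in
/-- `a ↦ ∑ a₍₀₎ φ(c · a₍₋₂₎)(d · a₍₋₁₎)`. -/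
def balanced (φ : C →ₗ[k] C →ₗ[k] A) (c d : C) : A →ₗ[k] A :=
  opMul k A ∘ₗ
    (lift φ ∘ₗ TensorProduct.map (ract k (A := H) c) (ract k (A := H) d)).rTensor A ∘ₗ
      (comul (R := k)).rTensor A ∘ₗ coact k H

/-- The bilinear maps `φ : C × C → A` with, for all `c, d ∈ C` and `a ∈ A`,
* `φ(c, d) a = ∑ a₍₀₎ φ(c · a₍₋₂₎, d · a₍₋₁₎)`, and
* `∑ c₍₁₎ ⊗ φ(c₍₂₎, d) = ∑ d₍₂₎ · φ(c, d₍₁₎)₍₋₁₎ ⊗ φ(c, d₍₁₎)₍₀₎`. -/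
def integrals : Submodule k (C →ₗ[k] C →ₗ[k] A) where
  carrier := {φ | (∀ (c d : C) (a : A), φ c d * a = balanced k H φ c d a) ∧
    ∀ c d : C, (φ.flip d).lTensor C (comul (R := k) c) = koppinenAux k H (φ c) d}
  zero_mem' := by
    constructor
    · intro c d a
      have h : lift (0 : C →ₗ[k] C →ₗ[k] A) = 0 := map_zero (lift.equiv (.id k) C C A)
      simp [balanced, h]
    · intro c d
      have h : (0 : C →ₗ[k] C →ₗ[k] A).flip d = 0 := by ext; simp
      simp [h, koppinenAux]
  add_mem' {φ ψ} hφ hψ := by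
    constructor
    · intro c d a
      have : balanced k H (φ + ψ) c d = balanced k H φ c d + balanced k H ψ c d := by
        have h : lift (φ + ψ) = lift φ + lift ψ := by ext; simp
        simp [balanced, h, LinearMap.rTensor_add, LinearMap.add_comp, LinearMap.comp_add]
      simp [add_mul, hφ.1, hψ.1, this]
    · intro c d
      have h : (φ + ψ).flip d = φ.flip d + ψ.flip d := by ext; simp
      simp [h, LinearMap.lTensor_add, hφ.2, hψ.2, koppinenAux]
  smul_mem' x φ hφ := by
    constructor
    · intro c d a
      have : balanced k H (x • φ) c d = x • balanced k H φ c d := by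
        have h : lift (x • φ) = x • lift φ := by ext; simp
        simp [balanced, h, LinearMap.rTensor_smul, LinearMap.smul_comp, LinearMap.comp_smul]
      simp [hφ.1, this]
    · intro c d
      have h : (x • φ).flip d = x • φ.flip d := by ext; simp
      simp [h, LinearMap.lTensor_smul, hφ.2, koppinenAux]

variable {k A C} in
/-- `∑ φ(c₍₁₎, c₍₂₎) = ε(c) 1` for all `c ∈ C`. -/
def IsNormalized (φ : C →ₗ[k] C →ₗ[k] A) : Prop :=
  ∀ c : C, lift φ (comul (R := k) c) = algebraMap k A (counit (R := k) c)

/-- An element `θ` of `#(C^cop ⊗ C, A)`, as the bilinear map `(c, d) ↦ θ(c ⊗ d)`. -/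
def bilin₃ : Koppinen k H (Cop C ⊗[k] C) A ≃ₗ[k] (C →ₗ[k] C →ₗ[k] A) :=
  Koppinen.toHom k H (Cop C ⊗[k] C) A ≪≫ₗ (lift.equiv (.id k) (Cop C) C A).symm ≪≫ₗ
    LinearEquiv.congrLeft (C →ₗ[k] A) k (toCop k).symm

/-- An element `γ` of `Hom(C^cop, #(C, A))`, as the bilinear map `(c, d) ↦ γ(c)(d)`. -/
def bilin₄ : WithConv (Cop C →ₗ[k] Koppinen k H C A) ≃ₗ[k] (C →ₗ[k] C →ₗ[k] A) :=
  WithConv.linearEquiv k _ ≪≫ₗ LinearEquiv.arrowCongr (toCop k).symm (Koppinen.toHom k H C A)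

/-- `V₃`, as a `k`-submodule of Koppinen's smash product `#(C^cop ⊗ C, A)`. -/
def V₃ : Submodule k (Koppinen k H (Cop C ⊗[k] C) A) :=
  (integrals k H A C).comap (bilin₃ k H A C).toLinearMap

/-- `V₄`, the `A`-integrals `γ : C → Hom(C, A)`, as a `k`-submodule of the convolution algebra
`Hom(C^cop, #(C, A))`. -/
def V₄ : Submodule k (WithConv (Cop C →ₗ[k] Koppinen k H C A)) :=
  (integrals k H A C).comap (bilin₄ k H A C).toLinearMap

end Integrals

/-! ### The explicit constructions -/

section Constructions

variable (k : Type*) [CommRing k]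

/-- `θ ↦ λ`, where `λ(c ⊗ d) = ∑ c₍₁₎ ⊗ θ(c₍₂₎ ⊗ d)`. -/
def g₂ {A C : Type*} [Ring A] [Algebra k A] [AddCommGroup C] [Module k C] [Coalgebra k C]
    (θ : C ⊗[k] C →ₗ[k] A) : C ⊗[k] C →ₗ[k] C ⊗[k] A :=
  θ.lTensor C ∘ₗ (TensorProduct.assoc k C C C).toLinearMap ∘ₗ (comul (R := k)).rTensor C

/-- `λ ↦ ν`, where `ν(c ⊗ d ⊗ a) = a λ(c ⊗ d)`, with `A` acting on the left of `C ⊗ A` by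
`a (c ⊗ b) = c ⊗ a b`. -/
def g₁ {A C : Type*} [Ring A] [Algebra k A] [AddCommGroup C] [Module k C]
    (l : C ⊗[k] C →ₗ[k] C ⊗[k] A) : C ⊗[k] (C ⊗[k] A) →ₗ[k] C ⊗[k] A :=
  (opMul k A).lTensor C ∘ₗ (TensorProduct.assoc k C A A).toLinearMap ∘ₗ l.rTensor A ∘ₗ
    (TensorProduct.assoc k C C A).symm.toLinearMap

/-- `ν ↦ ν_M`, where `ν_M(c ⊗ m) = ∑ m₍₀₎ ((ε ⊗ I)(ν(c ⊗ m₍₋₁₎ ⊗ 1)))`. -/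
def gApp (H : Type*) [Ring H] [Bialgebra k H]
    {A C : Type u} [Ring A] [Algebra k A] [ComoduleAlgebra k H A]
    [AddCommGroup C] [Module k C] [Coalgebra k C] [Module Hᵐᵒᵖ C] [IsScalarTower k Hᵐᵒᵖ C]
    (ν : C ⊗[k] (C ⊗[k] A) →ₗ[k] C ⊗[k] A) (M : DoiHopfMod.{u} k H A C) :
    C ⊗[k] M.carrier →ₗ[k] M.carrier :=
  lift (ract k (A := A) (M := M.carrier)).flip ∘ₗ
    ((TensorProduct.lid k A).toLinearMap ∘ₗ (counit (R := k)).rTensor A ∘ₗ ν ∘ₗ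
      ((TensorProduct.mk k C A).flip 1).lTensor C).rTensor M.carrier ∘ₗ
    (TensorProduct.assoc k C C M.carrier).symm.toLinearMap ∘ₗ (coact k C).lTensor C

end Constructions

end

end DoiHopf

/-! Everything reduces to one linear isomorphism: natural transformations `GF → 1` are the same as
bilinear maps `φ : C × C → A` in `integrals`. From `ν` one takes `φ(c, d) = (ε ⊗ I) ν(c ⊗ d ⊗ 1)` at
the Doi-Hopf module `C ⊗ A`; from `φ` one takes `ν_M(c ⊗ m) = ∑ m₍₀₎ φ(c, m₍₋₁₎)`.

That `φ` determines `ν` is a Yoneda-type argument (`V.app_tmul`). Naturality along `A → N`, `a ↦ n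
a`, reduces elements of `C ⊗ (C ⊗ N)` to those with `n = 1`; naturality along the coaction `M → C ⊗
M`, itself a morphism of Doi-Hopf modules, followed by `ε`, reduces an arbitrary `M` to a cofree
one. The two defining conditions on `φ` are then what `A`-linearity and `C`-colinearity of `ν`
amount to: `V.toIntegral_mem` in one direction, `integralMap_act` and `integralMap_coact` in the
other.

Under this correspondence the product of `V` becomes `(φ ψ)(c) = ∑ φ(c₍₂₎) • ψ(c₍₁₎)`, with `•` the
product of `#(C, A)` (`V.toIntegral_mul`). The products of `#(C^cop ⊗ C, A)` and of `Hom(C^cop, #(C,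
A))` are given by the same expression (`bilin₃_mul`, `bilin₄_mul`). So closure of `V₃` and `V₄`
under products and multiplicativity of the comparison maps need no direct computation with the two
conditions: they are transported from `V`. Likewise a normalized `φ` gives a splitting of `ρ`, and a
splitting is a right unit of `V` because composing with `ρ` and then `ν` is composing with the
identity.

Finally, the `ε` in `g` cancels the comultiplication introduced by `g₂`, so `g ∘ g₁ ∘ g₂` is exactly
the map `φ ↦ ν` above. -/

namespace DoiHopf

noncomputable section

/-! ### Evaluating bilinear maps against right modules and comodules. -/

section Pairing

variable (k : Type*) [CommRing k] {A : Type*} [Ring A] [Algebra k A]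
  {C : Type*} [AddCommGroup C] [Module k C]
  {N : Type*} [AddCommGroup N] [Module k N] [Module Aᵐᵒᵖ N] [IsScalarTower k Aᵐᵒᵖ N]

/-- The map `C ⊗ N → N`, `c ⊗ n ↦ n · f(c)`. -/
def pairing (f : C →ₗ[k] A) : C ⊗[k] N →ₗ[k] N :=
  lift ((ract k (A := A) (M := N)).flip ∘ₗ f)

@[simp] theorem pairing_tmul (f : C →ₗ[k] A) (c : C) (n : N) :
    pairing k f (c ⊗ₜ n) = op (f c) • n := rfl

theorem pairing_add (f f' : C →ₗ[k] A) (z : C ⊗[k] N) :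
    pairing k (f + f') z = pairing k f z + pairing k f' z := by
  induction z with
  | zero => simp
  | add x y hx hy => simp only [map_add, hx, hy, add_add_add_comm]
  | tmul c n => simp [add_smul]

theorem pairing_smul (x : k) (f : C →ₗ[k] A) (z : C ⊗[k] N) :
    pairing k (x • f) z = x • pairing k f z := by
  induction z with
  | zero => simp
  | add y z hy hz => simp only [map_add, smul_add, hy, hz]
  | tmul c n => simp [smul_assoc]

variable (N) in
/-- The map `C ⊗ (C ⊗ N) → N`, `c ⊗ (d ⊗ n) ↦ n · φ(c, d)`. -/
def bipairing (φ : C →ₗ[k] C →ₗ[k] A) : C ⊗[k] (C ⊗[k] N) →ₗ[k] N :=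
  lift (ract k (A := A) (M := N)).flip ∘ₗ (lift φ).rTensor N ∘ₗ
    (TensorProduct.assoc k C C N).symm.toLinearMap

theorem bipairing_assoc_tmul (φ : C →ₗ[k] C →ₗ[k] A) (w : C ⊗[k] C) (n : N) :
    bipairing k N φ (TensorProduct.assoc k C C N (w ⊗ₜ n)) = op (lift φ w) • n := by
  simp [bipairing]

theorem bipairing_tmul (φ : C →ₗ[k] C →ₗ[k] A) (c : C) (z : C ⊗[k] N) :
    bipairing k N φ (c ⊗ₜ z) = pairing k (φ c) z := by
  induction z with
  | zero => simp
  | add x y hx hy => simp only [map_add, tmul_add, hx, hy]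
  | tmul d n => simp [bipairing]

variable [Coalgebra k C] [LeftComodule k C N]

variable (N) in
/-- The map `C ⊗ N → N`, `c ⊗ n ↦ ∑ n₍₀₎ · φ(c, n₍₋₁₎)`. -/
def integralMap (φ : C →ₗ[k] C →ₗ[k] A) : C ⊗[k] N →ₗ[k] N :=
  bipairing k N φ ∘ₗ (coact k C).lTensor C

theorem integralMap_tmul (φ : C →ₗ[k] C →ₗ[k] A) (c : C) (n : N) :
    integralMap k N φ (c ⊗ₜ n) = pairing k (φ c) (coact k C n) := by
  rw [integralMap, LinearMap.comp_apply, LinearMap.lTensor_tmul, bipairing_tmul]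

/-- Putting `a = 1` undoes `g₁`, and `∑ ε(c₍₁₎) c₍₂₎ = c` undoes `g₂`. This is what identifies the
composite `g ∘ g₁ ∘ g₂` with `integralMap`. -/
theorem counit_g₁_g₂ (θ : C ⊗[k] C →ₗ[k] A) :
    (TensorProduct.lid k A).toLinearMap ∘ₗ (counit (R := k)).rTensor A ∘ₗ g₁ k (g₂ k θ) ∘ₗ
      ((TensorProduct.mk k C A).flip 1).lTensor C = θ := by
  refine TensorProduct.ext' fun c d => ?_
  have h : ∀ w : C ⊗[k] C, TensorProduct.lid k A ((counit (R := k)).rTensor A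
      ((opMul k A).lTensor C (TensorProduct.assoc k C A A
        (θ.lTensor C (TensorProduct.assoc k C C C (w ⊗ₜ d)) ⊗ₜ 1)))) =
      θ (TensorProduct.lid k C ((counit (R := k)).rTensor C w) ⊗ₜ d) := by
    intro w
    induction w with
    | zero => simp
    | add x y hx hy => simp only [map_add, add_tmul, hx, hy]
    | tmul a b => simp [← smul_tmul']
  simpa [g₁, g₂] using h (comul (R := k) c)

end Pairing

/-! ### Iterated coactions and counits. -/

section Balanced

variable (k : Type*) [CommRing k] (H : Type*) [Ring H] [Bialgebra k H]
  {A : Type*} [Ring A] [Algebra k A] [ComoduleAlgebra k H A]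
  {C : Type*} [AddCommGroup C] [Module k C] [Coalgebra k C] [Module Hᵐᵒᵖ C]
  [IsScalarTower k Hᵐᵒᵖ C]

/-- The map `h ⊗ b ↦ ∑ b₍₀₎ φ(c · h, d · b₍₋₁₎)`. -/
def balancedAux (φ : C →ₗ[k] C →ₗ[k] A) (c d : C) : H ⊗[k] A →ₗ[k] A :=
  lift (LinearMap.mk₂ k
    (fun (h : H) (b : A) => opMul k A ((φ (op h • c)).rTensor A (twist k H A C d b)))
    (fun h h' b => by simp [add_smul, LinearMap.rTensor_add])
    (fun x h b => by
      rw [op_smul, smul_assoc]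
      simp [LinearMap.rTensor_smul])
    (fun h b b' => by simp) (fun x h b => by simp))

theorem balancedAux_tmul (φ : C →ₗ[k] C →ₗ[k] A) (c d : C) (h : H) (b : A) :
    balancedAux k H φ c d (h ⊗ₜ b) =
      opMul k A ((φ (op h • c)).rTensor A (twist k H A C d b)) := rfl

/-- Coassociativity of the coaction of `A`: splitting `a₍₋₁₎` by comultiplication agrees with
coacting again on `a₍₀₎`. The second form is the one that arises when `a` acts on `C ⊗ (C ⊗ N)`. -/
theorem balanced_eq (φ : C →ₗ[k] C →ₗ[k] A) (c d : C) (a : A) :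
    balanced k H φ c d a = balancedAux k H φ c d (coact k H a) := by
  let L : H ⊗[k] (H ⊗[k] A) →ₗ[k] A := opMul k A ∘ₗ
    (lift φ ∘ₗ TensorProduct.map (ract k (A := H) c) (ract k (A := H) d)).rTensor A ∘ₗ
      (TensorProduct.assoc k H H A).symm.toLinearMap
  have h1 : ∀ w : H ⊗[k] A, balancedAux k H φ c d w = L ((coact k H).lTensor H w) := by
    intro w
    induction w with
    | zero => simp
    | add x y hx hy => simp only [map_add, hx, hy]
    | tmul h b =>
      rw [balancedAux_tmul, twist_apply, LinearMap.lTensor_tmul]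
      induction coact k H b with
      | zero => simp
      | add x y hx hy => simp only [map_add, tmul_add, hx, hy]
      | tmul g b => simp [L]
  have h3 : TensorProduct.assoc k H H A ((comul (R := k)).rTensor A (coact k H a)) =
      (coact k H).lTensor H (coact k H a) := LeftComodule.coassoc a
  rw [h1, ← h3]
  simp [L, balanced]

/-- Three counit axioms in turn: `ε(d · h) = ε(d) ε(h)`, then that of the comodule `A`, then that of
`C`. -/
theorem counit_koppinenAux (f : C →ₗ[k] A) (d : C) [ModuleCoalgebra k H C] :
    TensorProduct.lid k A ((counit (R := k)).rTensor A (koppinenAux k H f d)) = f d := by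
  have h1 : ∀ (e : C) (x : A), TensorProduct.lid k A ((counit (R := k)).rTensor A
      (twist k H A C e x)) = counit (R := k) e • x := by
    intro e x
    have h2 : TensorProduct.lid k A ((counit (R := k)).rTensor A (coact k H x)) = x :=
      LeftComodule.counit_coact x
    rw [twist_apply]
    conv_rhs => rw [← h2]
    induction coact k H x with
    | zero => simp
    | add x y hx hy => simp only [map_add, smul_add, hx, hy]
    | tmul h b => simp [ModuleCoalgebra.counit_act, mul_smul]
  have h2 : ∀ w : C ⊗[k] C, TensorProduct.lid k A ((counit (R := k)).rTensor A
      (lift (twist k H A C) (f.lTensor C (TensorProduct.comm k C C w)))) =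
      f (TensorProduct.rid k C ((counit (R := k)).lTensor C w)) := by
    intro w
    induction w with
    | zero => simp
    | add x y hx hy => simp only [map_add, hx, hy]
    | tmul a d => simp [h1]
  simpa [koppinenAux] using h2 (comul (R := k) d)

end Balanced

/-! ### The common form of the products on `V₃` and `V₄`. -/

section Convolution

variable (k : Type*) [CommRing k] (H : Type*) [Ring H] [Bialgebra k H]
  {A : Type*} [Ring A] [Algebra k A] [ComoduleAlgebra k H A]
  {C : Type*} [AddCommGroup C] [Module k C] [Coalgebra k C] [Module Hᵐᵒᵖ C]
  [IsScalarTower k Hᵐᵒᵖ C]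

/-- The map `c ⊗ c' ↦ φ(c', -) • ψ(c, -)`, with the product of `#(C, A)`. -/
def copMul (φ ψ : C →ₗ[k] C →ₗ[k] A) : C ⊗[k] C →ₗ[k] C →ₗ[k] A :=
  lift (LinearMap.mk₂ k (fun c c' => koppinenMul k H (φ c') (ψ c))
    (fun c d e => by simp [koppinenMul_add_right])
    (fun x c d => by simp [koppinenMul_smul_right])
    (fun c d e => by simp [koppinenMul_add_left])
    (fun x c d => by simp [koppinenMul_smul_left]))

@[simp] theorem copMul_tmul (φ ψ : C →ₗ[k] C →ₗ[k] A) (c c' : C) :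
    copMul k H φ ψ (c ⊗ₜ c') = koppinenMul k H (φ c') (ψ c) := rfl

variable [ModuleCoalgebra k H C]

/-- The co-opposite comultiplication hands `c₍₂₎` to the left factor and `c₍₁₎` to the right one,
which is the order built into `copMul`. -/
theorem bilin₄_mul (γ γ' : WithConv (Cop C →ₗ[k] Koppinen k H C A)) (c : C) :
    bilin₄ k H A C (γ * γ') c =
      copMul k H (bilin₄ k H A C γ) (bilin₄ k H A C γ') (comul (R := k) c) := by
  have h : ∀ w : C ⊗[k] C, Koppinen.toHom k H C A (LinearMap.mul' k (Koppinen k H C A)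
      (TensorProduct.map γ.ofConv γ'.ofConv (TensorProduct.map (toCop k).toLinearMap
        (toCop k).toLinearMap (TensorProduct.comm k C C w)))) =
      copMul k H (bilin₄ k H A C γ) (bilin₄ k H A C γ') w := by
    intro w
    induction w with
    | zero => simp
    | add x y hx hy => simp only [map_add, hx, hy]
    | tmul a b => rfl
  rw [← h, ← comul_toCop]
  rfl

/-- `H` acts on `C^cop ⊗ C` through the second factor only, and the comultiplication is
componentwise. Hence the Koppinen product is plain convolution in the `C^cop` variable and the
product of `#(C, A)` in the other. -/
theorem bilin₃_mul (θ θ' : Koppinen k H (Cop C ⊗[k] C) A) (c : C) :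
    bilin₃ k H A C (θ * θ') c =
      copMul k H (bilin₃ k H A C θ) (bilin₃ k H A C θ') (comul (R := k) c) := by
  ext d
  set f := Koppinen.toHom k H (Cop C ⊗[k] C) A θ
  set f' := Koppinen.toHom k H (Cop C ⊗[k] C) A θ'
  have hf : ∀ x y, bilin₃ k H A C θ x y = f (toCop k x ⊗ₜ y) := fun _ _ => rfl
  have hf' : ∀ x y, bilin₃ k H A C θ' x y = f' (toCop k x ⊗ₜ y) := fun _ _ => rfl
  have h0 : ∀ (x y : C) (b : A), opMul k A (f'.rTensor A
      (twist k H A (Cop C ⊗[k] C) (toCop k x ⊗ₜ y) b)) =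
      opMul k A ((bilin₃ k H A C θ' x).rTensor A (twist k H A C y b)) := by
    intro x y b
    rw [twist_apply, twist_apply]
    induction coact k H b with
    | zero => simp
    | add x y hx hy => simp only [map_add, hx, hy]
    | tmul g b => simp [hf', copTensor_smul]
  have h1 : ∀ (a b : C) (v : C ⊗[k] C), opMul k A (f'.rTensor A
      (lift (twist k H A (Cop C ⊗[k] C)) (f.lTensor _ (TensorProduct.comm k _ _
        (AlgebraTensorModule.tensorTensorTensorComm k k k k (Cop C) (Cop C) C C
          ((toCop k b ⊗ₜ toCop k a) ⊗ₜ v)))))) =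
      opMul k A ((bilin₃ k H A C θ' a).rTensor A (lift (twist k H A C)
        ((bilin₃ k H A C θ b).lTensor C (TensorProduct.comm k C C v)))) := by
    intro a b v
    induction v with
    | zero => simp
    | add x y hx hy => simp only [map_add, tmul_add, hx, hy]
    | tmul x y => simp [h0, hf]
  have h : ∀ w : C ⊗[k] C, opMul k A (f'.rTensor A (lift (twist k H A (Cop C ⊗[k] C))
      (f.lTensor _ (TensorProduct.comm k _ _ (AlgebraTensorModule.tensorTensorTensorComm
        k k k k (Cop C) (Cop C) C C ((TensorProduct.map (toCop k).toLinearMap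
        (toCop k).toLinearMap (TensorProduct.comm k C C w)) ⊗ₜ comul d)))))) =
      copMul k H (bilin₃ k H A C θ) (bilin₃ k H A C θ') w d := by
    intro w
    induction w with
    | zero => simp
    | add x y hx hy => simp only [map_add, add_tmul, LinearMap.add_apply, hx, hy]
    | tmul a b => exact h1 a b _
  rw [← h, ← comul_toCop, ← TensorProduct.comul_tmul]
  rfl

end Convolution

/-! ### Natural transformations `GF → 1` correspond to integrals. -/

section Correspondence

variable {k : Type*} [CommRing k] {H : Type*} [Ring H] [Bialgebra k H]
  {A : Type u} [Ring A] [Algebra k A] [ComoduleAlgebra k H A]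
  {C : Type u} [AddCommGroup C] [Module k C] [Coalgebra k C] [Module Hᵐᵒᵖ C]
  [IsScalarTower k Hᵐᵒᵖ C] [ModuleCoalgebra k H C]

variable (k A) in
/-- The algebra `A` as a right module over itself. -/
abbrev regularMod : RightMod.{u} k A where
  carrier := A

/-- The map `A → N`, `a ↦ n · a`. -/
def actHom (N : RightMod.{u} k A) (n : N.carrier) : regularMod k A ⟶ N :=
  ⟨ract k (A := A) n, fun a b => mul_smul (op a) (op b) n⟩

/-- The component `C ⊗ (C ⊗ N) → C ⊗ N` of `ν` at `C ⊗ N`. -/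
def V.cofreeApp (ν : V k H A C) (N : RightMod.{u} k A) :
    C ⊗[k] (C ⊗[k] N.carrier) →ₗ[k] C ⊗[k] N.carrier :=
  ν.app ((cofree k H A C).obj N)

theorem V.ext_app {ν ν' : V k H A C} (h : ∀ M, ν.app M = ν'.app M) : ν = ν' :=
  NatTrans.ext (funext fun M => DoiHopfMod.hom_ext _ _ _ _ (h M))

theorem V.cofreeApp_act (ν : V k H A C) (N : RightMod.{u} k A) (x : C ⊗[k] (C ⊗[k] N.carrier))
    (a : A) : ν.cofreeApp N (map₂ (ract k (A := H)) (cofreeAct k H C N) x (coact k H a)) =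
      cofreeAct k H C N (ν.cofreeApp N x) a :=
  (ν.toNatTrans.app ((cofree k H A C).obj N)).2.1 a x

theorem V.coact_app (ν : V k H A C) (M : DoiHopfMod.{u} k H A C) (x : C ⊗[k] M.carrier) :
    coact k C (ν.app M x) = (ν.app M).lTensor C
      (TensorProduct.assoc k C C M.carrier ((comul (R := k)).rTensor M.carrier x)) :=
  (ν.toNatTrans.app M).2.2 x

theorem V.cofreeApp_map (ν : V k H A C) {N N' : RightMod.{u} k A} (f : N ⟶ N')
    (x : C ⊗[k] (C ⊗[k] N.carrier)) :
    ν.cofreeApp N' ((f.1.lTensor C).lTensor C x) = f.1.lTensor C (ν.cofreeApp N x) :=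
  LinearMap.congr_fun (congrArg DoiHopfMod.toLin
    (ν.toNatTrans.naturality ((cofree k H A C).map f))) x

/-- Naturality at the morphism `M → C ⊗ M` given by the unit `ρ`; it compares an arbitrary `M` with
a cofree module. -/
theorem V.cofreeApp_coact (ν : V k H A C) (M : DoiHopfMod.{u} k H A C)
    (x : C ⊗[k] M.carrier) :
    ν.cofreeApp M.toRightMod ((coact k C (M := M.carrier)).lTensor C x) =
      coact k C (ν.app M x) :=
  LinearMap.congr_fun (congrArg DoiHopfMod.toLin
    (ν.toNatTrans.naturality ((unitCoaction k H A C).app M))) x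

/-- The integral `φ(c, d) = (ε ⊗ I)(ν(c ⊗ d ⊗ 1))` of a natural transformation `ν`. -/
def V.toIntegral (ν : V k H A C) : C →ₗ[k] C →ₗ[k] A :=
  curry ((TensorProduct.lid k A).toLinearMap ∘ₗ (counit (R := k)).rTensor A ∘ₗ
    ν.cofreeApp (regularMod k A) ∘ₗ ((TensorProduct.mk k C A).flip 1).lTensor C)

theorem V.toIntegral_apply (ν : V k H A C) (c d : C) :
    ν.toIntegral c d = TensorProduct.lid k A ((counit (R := k)).rTensor A
      (ν.cofreeApp (regularMod k A) (c ⊗ₜ (d ⊗ₜ (1 : A))))) := rfl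

/-- Naturality along `a ↦ n a` carries the value at `c ⊗ d ⊗ 1` to the value at `c ⊗ d ⊗ n`. -/
theorem V.counit_cofreeApp (ν : V k H A C) (N : RightMod.{u} k A) (c d : C) (n : N.carrier) :
    TensorProduct.lid k N.carrier ((counit (R := k)).rTensor N.carrier
      (ν.cofreeApp N (c ⊗ₜ (d ⊗ₜ n)))) = op (ν.toIntegral c d) • n := by
  have h := ν.cofreeApp_map (actHom N n) (c ⊗ₜ (d ⊗ₜ (1 : A)))
  have h1 : (actHom N n).1 (1 : A) = n := one_smul Aᵐᵒᵖ n
  rw [LinearMap.lTensor_tmul, LinearMap.lTensor_tmul, h1] at h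
  rw [h, toIntegral_apply]
  generalize ν.cofreeApp (regularMod k A) (c ⊗ₜ (d ⊗ₜ (1 : A))) = w
  induction w with
  | zero => simp
  | add x y hx hy => simp only [map_add, MulOpposite.op_add, add_smul, hx, hy]
  | tmul e a => exact (map_smul (ract k (A := A) n) (counit (R := k) e) a).symm

/-- By the counit axiom `ν_M = (ε ⊗ I) ∘ ρ_M ∘ ν_M`, and naturality rewrites `ρ_M ∘ ν_M` as `ν_{C ⊗
M} ∘ (C ⊗ ρ_M)`, which is known after applying `ε`. Thus the integral determines `ν`. -/
theorem V.app_tmul (ν : V k H A C) (M : DoiHopfMod.{u} k H A C) (c : C) (m : M.carrier) :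
    ν.app M (c ⊗ₜ m) = pairing k (ν.toIntegral c) (coact k C m) := by
  have h := ν.cofreeApp_coact M (c ⊗ₜ m)
  rw [LinearMap.lTensor_tmul] at h
  have h1 : ∀ w : C ⊗[k] M.carrier, TensorProduct.lid k M.carrier
      ((counit (R := k)).rTensor M.carrier (ν.cofreeApp M.toRightMod (c ⊗ₜ w))) =
      pairing k (ν.toIntegral c) w := by
    intro w
    induction w with
    | zero => simp
    | add x y hx hy => simp only [map_add, tmul_add, hx, hy]
    | tmul d m => exact ν.counit_cofreeApp M.toRightMod c d m
  rw [← h1, h]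
  exact (LeftComodule.counit_coact (ν.app M (c ⊗ₜ m))).symm

theorem cofreeAct_one_tmul (e : C) (a : A) :
    cofreeAct k H C (regularMod k A) (e ⊗ₜ (1 : A)) a = twist k H A C e a := by
  have h : ∀ w : H ⊗[k] A, map₂ (ract k (A := H) (M := C)) (ract k (A := A) (M := A))
      (e ⊗ₜ (1 : A)) w = (ract k (A := H) e).rTensor A w := by
    intro w
    induction w with
    | zero => simp
    | add x y hx hy => simp only [map_add, hx, hy]
    | tmul g b => simp [map₂_apply_tmul]
  exact h _

/-- In `C ⊗ A` one has `(e ⊗ 1) a = ∑ e · a₍₋₁₎ ⊗ a₍₀₎`, so pairing `f` with the coaction of `d ⊗ 1`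
gives `∑ (d₍₂₎ ⊗ 1) f(d₍₁₎)`. This is where Koppinen's product enters. -/
theorem pairing_cofree (f : C →ₗ[k] A) (d : C) :
    lift ((cofreeAct k H C (regularMod k A)).flip ∘ₗ f)
      (TensorProduct.assoc k C C A (comul (R := k) d ⊗ₜ 1)) = koppinenAux k H f d := by
  simp only [koppinenAux, LinearMap.comp_apply, LinearEquiv.coe_coe]
  induction comul (R := k) d with
  | zero => simp
  | add x y hx hy => simp only [map_add, add_tmul, hx, hy]
  | tmul x y => exact cofreeAct_one_tmul y (f x)

theorem V.cofreeApp_one (ν : V k H A C) (c d : C) :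
    ν.cofreeApp (regularMod k A) (c ⊗ₜ (d ⊗ₜ (1 : A))) =
      koppinenAux k H (ν.toIntegral c) d := by
  rw [← pairing_cofree]
  exact ν.app_tmul ((cofree k H A C).obj (regularMod k A)) c (d ⊗ₜ (1 : A))

theorem V.counit_cofreeApp_regular (ν : V k H A C) (c : C) (z : C ⊗[k] A) :
    TensorProduct.lid k A ((counit (R := k)).rTensor A
      (ν.cofreeApp (regularMod k A) (c ⊗ₜ z))) =
      opMul k A ((ν.toIntegral c).rTensor A z) := by
  induction z with
  | zero => simp
  | add x y hx hy => simp only [map_add, tmul_add, hx, hy]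
  | tmul d a =>
    rw [LinearMap.rTensor_tmul, opMul_tmul]
    exact ν.counit_cofreeApp (regularMod k A) c d a

/-- The first condition is `A`-linearity of `ν` at `c ⊗ d ⊗ 1`, seen through the `A`-linear map `ε ⊗
I`. The second is colinearity at the same element, with `V.cofreeApp_one` supplying the right-hand
side. -/
theorem V.toIntegral_mem (ν : V k H A C) : ν.toIntegral ∈ integrals k H A C := by
  constructor
  · intro c d a
    rw [balanced_eq, toIntegral_apply]
    have h1 : ∀ w : H ⊗[k] A, TensorProduct.lid k A ((counit (R := k)).rTensor A
        (ν.cofreeApp (regularMod k A) (map₂ (ract k (A := H))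
          (cofreeAct k H C (regularMod k A)) (c ⊗ₜ (d ⊗ₜ (1 : A))) w))) =
        balancedAux k H ν.toIntegral c d w := by
      intro w
      induction w with
      | zero => simp
      | add x y hx hy => simp only [map_add, hx, hy]
      | tmul h b =>
        rw [map₂_apply_tmul, TensorProduct.map_tmul, cofreeAct_one_tmul,
          counit_cofreeApp_regular, balancedAux_tmul, ract_apply]
    rw [← h1, cofreeApp_act]
    exact (counit_cofreeAct k H C (regularMod k A) _ a).symm
  · intro c d
    rw [← cofreeApp_one]
    have h : ∀ w : C ⊗[k] C,
        ((TensorProduct.lid k A).toLinearMap ∘ₗ (counit (R := k)).rTensor A).lTensor C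
          ((ν.cofreeApp (regularMod k A)).lTensor C
            (TensorProduct.assoc k C C (C ⊗[k] A) (w ⊗ₜ (d ⊗ₜ (1 : A))))) =
          (ν.toIntegral.flip d).lTensor C w := by
      intro w
      induction w with
      | zero => simp
      | add x y hx hy => simp only [map_add, add_tmul, hx, hy]
      | tmul e e' => rfl
    rw [← h]
    have h1 := ν.coact_app ((cofree k H A C).obj (regularMod k A)) (c ⊗ₜ (d ⊗ₜ (1 : A)))
    refine (congrArg (((TensorProduct.lid k A).toLinearMap ∘ₗ
      (counit (R := k)).rTensor A).lTensor C) h1).symm.trans ?_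
    -- Coacting on `C ⊗ A` and then applying `ε` to the second leg is the identity.
    exact LinearMap.congr_fun (counit_coact_cofree k C A) _

/-- Colinearity gives `ρ(ν(c ⊗ d ⊗ 1)) = ∑ c₍₁₎ ⊗ ν(c₍₂₎ ⊗ d ⊗ 1)`. So the inner `ν` sees `c₍₂₎` and
the outer `ν'` sees `c₍₁₎`, whence the co-opposite order. -/
theorem V.toIntegral_mul (ν ν' : V k H A C) (c : C) :
    (ν * ν').toIntegral c = copMul k H ν.toIntegral ν'.toIntegral (comul (R := k) c) := by
  ext d
  have h : ∀ w : C ⊗[k] C, TensorProduct.lid k A ((counit (R := k)).rTensor A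
      (ν'.cofreeApp (regularMod k A) ((ν.cofreeApp (regularMod k A)).lTensor C
            (TensorProduct.assoc k C C (C ⊗[k] A) (w ⊗ₜ (d ⊗ₜ (1 : A))))))) =
      copMul k H ν.toIntegral ν'.toIntegral w d := by
    intro w
    induction w with
    | zero => simp
    | add x y hx hy => simp only [map_add, add_tmul, LinearMap.add_apply, hx, hy]
    | tmul e e' =>
      rw [TensorProduct.assoc_tmul, LinearMap.lTensor_tmul, cofreeApp_one,
        counit_cofreeApp_regular]
      rfl
  rw [← h]
  have h1 := ν.coact_app ((cofree k H A C).obj (regularMod k A)) (c ⊗ₜ (d ⊗ₜ (1 : A)))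
  exact congrArg (fun z => TensorProduct.lid k A ((counit (R := k)).rTensor A
      (ν'.cofreeApp (regularMod k A) z))) h1

/-- By the Doi-Hopf compatibility, `(c ⊗ m) a` goes to `∑ m₍₀₎ a₍₀₎ φ(c · a₍₋₂₎, m₍₋₁₎ · a₍₋₁₎)`,
and the first condition on `φ` turns this into `∑ m₍₀₎ φ(c, m₍₋₁₎) a`. -/
theorem integralMap_act {φ : C →ₗ[k] C →ₗ[k] A} (hφ : φ ∈ integrals k H A C)
    (M : DoiHopfMod.{u} k H A C) (x : C ⊗[k] M.carrier) (a : A) :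
    integralMap k M.carrier φ (cofreeAct k H C M.toRightMod x a) =
      op a • integralMap k M.carrier φ x := by
  induction x with
  | zero => simp
  | add x y hx hy => simp only [map_add, LinearMap.add_apply, smul_add, hx, hy]
  | tmul c m =>
    rw [integralMap_tmul]
    -- `Q` makes the coactions of `m` and of `a` independent arguments, so that each can be replaced
    -- by a pure tensor.
    let Q : C ⊗[k] M.carrier →ₗ[k] H ⊗[k] A →ₗ[k] M.carrier := (lift (LinearMap.mk₂ k
      (fun g b => pairing k (φ (op g • c)) ∘ₗ
        (map₂ (ract k (A := H)) (ract k (A := A))).flip (coact k H b))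
      (fun g g' b => by ext; simp [add_smul, pairing_add])
      (fun x g b => by
        rw [op_smul, smul_assoc]
        ext
        simp [pairing_smul])
      (fun g b b' => by ext; simp) (fun x g b => by ext; simp))).flip
    have hQ : ∀ g b z, Q z (g ⊗ₜ b) = pairing k (φ (op g • c))
      (map₂ (ract k (A := H)) (ract k (A := A)) z (coact k H b)) := fun _ _ _ => rfl
    have h1 : ∀ u : H ⊗[k] A, integralMap k M.carrier φ
        (map₂ (ract k (A := H)) (ract k (A := A)) (c ⊗ₜ m) u) = Q (coact k C m) u := by
      intro u
      induction u with
      | zero => simp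
      | add x y hx hy => simp only [map_add, hx, hy]
      | tmul g b =>
        rw [map₂_apply_tmul, TensorProduct.map_tmul, integralMap_tmul, hQ]
        exact congrArg _ (M.coact_act m b)
    have h2 : ∀ (f : C →ₗ[k] A) (e : C) (n : M.carrier) (w : H ⊗[k] A),
        pairing k f (map₂ (ract k (A := H)) (ract k (A := A)) (e ⊗ₜ n) w) =
          op (opMul k A (f.rTensor A ((ract k (A := H) e).rTensor A w))) • n := by
      intro f e n w
      induction w with
      | zero => simp
      | add x y hx hy => simp only [map_add, MulOpposite.op_add, add_smul, hx, hy]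
      | tmul g b => simp [map₂_apply_tmul, mul_smul]
    have h3 : ∀ (e : C) (n : M.carrier) (u : H ⊗[k] A),
        Q (e ⊗ₜ n) u = op (balancedAux k H φ c e u) • n := by
      intro e n u
      induction u with
      | zero => simp
      | add x y hx hy => simp only [map_add, MulOpposite.op_add, add_smul, hx, hy]
      | tmul g b => rw [hQ, h2, balancedAux_tmul, twist_apply]
    have h4 : ∀ z : C ⊗[k] M.carrier, Q z (coact k H a) = op a • pairing k (φ c) z := by
      intro z
      induction z with
      | zero => simp
      | add x y hx hy => simp only [map_add, LinearMap.add_apply, smul_add, hx, hy]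
      | tmul e n => rw [h3, ← balanced_eq, ← hφ.1, op_mul, mul_smul, pairing_tmul]
    rw [← h4, ← h1]
    rfl

/-- The coaction of `∑ m₍₀₎ φ(c, m₍₋₁₎)` is `∑ m₍₋₁₎ · φ(c, m₍₋₂₎)₍₋₁₎ ⊗ m₍₀₎ φ(c, m₍₋₂₎)₍₀₎`. The
second condition, with `d = m₍₋₁₎` before it is split, rewrites it as `∑ c₍₁₎ ⊗ m₍₀₎ φ(c₍₂₎,
m₍₋₁₎)`. -/
theorem integralMap_coact {φ : C →ₗ[k] C →ₗ[k] A} (hφ : φ ∈ integrals k H A C)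
    (M : DoiHopfMod.{u} k H A C) (x : C ⊗[k] M.carrier) :
    coact k C (integralMap k M.carrier φ x) = (integralMap k M.carrier φ).lTensor C
      (TensorProduct.assoc k C C M.carrier ((comul (R := k)).rTensor M.carrier x)) := by
  induction x with
  | zero => simp
  | add x y hx hy => simp only [map_add, hx, hy]
  | tmul c m =>
    let R : C ⊗[k] (C ⊗[k] M.carrier) →ₗ[k] C ⊗[k] M.carrier :=
      lift ((map₂ (ract k (A := H)) (ract k (A := A))).flip ∘ₗ coact k H ∘ₗ φ c)
    have h1 : ∀ z : C ⊗[k] M.carrier, coact k C (pairing k (φ c) z) =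
        R ((coact k C).lTensor C z) := by
      intro z
      induction z with
      | zero => simp
      | add x y hx hy => simp only [map_add, hx, hy]
      | tmul e n => exact M.coact_act n (φ c e)
    have h2 : ∀ (e : C) (n : M.carrier) (w : H ⊗[k] A),
        map₂ (ract k (A := H)) (ract k (A := A)) (e ⊗ₜ n) w =
          (ract k (A := A) n).lTensor C ((ract k (A := H) e).rTensor A w) := by
      intro e n w
      induction w with
      | zero => simp
      | add x y hx hy => simp only [map_add, hx, hy]
      | tmul g b => simp [map₂_apply_tmul]
    have h3 : ∀ (n : M.carrier) (v : C ⊗[k] C), R (TensorProduct.assoc k C C _ (v ⊗ₜ n)) =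
        (ract k (A := A) n).lTensor C (lift (twist k H A C) ((φ c).lTensor C
          (TensorProduct.comm k C C v))) := by
      intro n v
      induction v with
      | zero => simp
      | add x y hx hy => simp only [map_add, add_tmul, hx, hy]
      | tmul e e' => exact h2 e' n _
    have h4 : ∀ (e : C) (n : M.carrier) (w : C ⊗[k] C),
        (ract k (A := A) n).lTensor C ((φ.flip e).lTensor C w) =
          (bipairing k M.carrier φ).lTensor C
            (TensorProduct.assoc k C C _ (w ⊗ₜ (e ⊗ₜ n))) := by
      intro e n w
      induction w with
      | zero => simp
      | add x y hx hy => simp only [map_add, add_tmul, hx, hy]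
      | tmul x y => simp [bipairing_tmul]
    have h5 : ∀ z : C ⊗[k] M.carrier,
        R (TensorProduct.assoc k C C _ ((comul (R := k)).rTensor _ z)) =
          (bipairing k M.carrier φ).lTensor C
            (TensorProduct.assoc k C C _ (comul (R := k) c ⊗ₜ z)) := by
      intro z
      induction z with
      | zero => simp
      | add x y hx hy => simp only [map_add, tmul_add, hx, hy]
      | tmul e n =>
        rw [LinearMap.rTensor_tmul, h3, ← h4, hφ.2]
        rfl
    have h6 : ∀ w : C ⊗[k] C, (integralMap k M.carrier φ).lTensor C
        (TensorProduct.assoc k C C _ (w ⊗ₜ m)) = (bipairing k M.carrier φ).lTensor C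
          (TensorProduct.assoc k C C _ (w ⊗ₜ coact k C m)) := by
      intro w
      induction w with
      | zero => simp
      | add x y hx hy => simp only [map_add, add_tmul, hx, hy]
      | tmul x y => rfl
    -- Coassociativity in `M` exposes the comultiplied `m₍₋₁₎` to which the second condition, used
    -- in `h5`, applies.
    have h7 : TensorProduct.assoc k C C _ ((comul (R := k)).rTensor _ (coact k C m)) =
        (coact k C).lTensor C (coact k C m) := LeftComodule.coassoc m
    rw [integralMap_tmul, h1, ← h7, h5, LinearMap.rTensor_tmul, h6]

/-- The natural transformation `c ⊗ m ↦ ∑ m₍₀₎ · φ(c, m₍₋₁₎)` given by an integral `φ`. -/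
def V.ofIntegral (φ : integrals k H A C) : V k H A C :=
  (show forgetCoaction k H A C ⋙ cofree k H A C ⟶ 𝟭 (DoiHopfMod.{u} k H A C) from
  { app M := ⟨integralMap k M.carrier φ.1, fun a x => integralMap_act φ.2 M x a,
      integralMap_coact φ.2 M⟩
    naturality M N f := by
      apply DoiHopfMod.hom_ext
      refine TensorProduct.ext' fun c (m : M.carrier) => ?_
      have h : ∀ w : C ⊗[k] M.carrier, pairing k (φ.1 c) (f.1.lTensor C w) =
          f.1 (pairing k (φ.1 c) w) := by
        intro w
        induction w with
        | zero => simp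
        | add x y hx hy => simp only [map_add, hx, hy]
        | tmul e m => exact (f.2.1 (φ.1 c e) m).symm
      refine (integralMap_tmul k φ.1 c (f.1 m)).trans (Eq.trans ?_
        (congrArg f.1 (integralMap_tmul k φ.1 c m)).symm)
      rw [← h]
      exact congrArg _ (f.2.2 m) })

theorem V.ofIntegral_app (φ : integrals k H A C) (M : DoiHopfMod.{u} k H A C) :
    (V.ofIntegral φ).app M = integralMap k M.carrier φ.1 := rfl

/-- At `d ⊗ 1 ∈ C ⊗ A` the transformation has the value `koppinenAux k H (φ.1 c) d`, and `ε`
recovers `φ(c, d)` from it. -/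
theorem V.toIntegral_ofIntegral (φ : integrals k H A C) :
    (V.ofIntegral φ).toIntegral = φ.1 := by
  ext c d
  have h : (V.ofIntegral φ).cofreeApp (regularMod k A) (c ⊗ₜ (d ⊗ₜ (1 : A))) =
      koppinenAux k H (φ.1 c) d := by
    rw [← pairing_cofree]
    exact integralMap_tmul k (N := ((cofree k H A C).obj (regularMod k A)).carrier) φ.1 c
      (d ⊗ₜ (1 : A) : C ⊗[k] A)
  rw [toIntegral_apply, h, counit_koppinenAux]

variable (k H A C) in
/-- The correspondence between natural transformations `GF → 1` and integrals. -/
def V.integralEquiv : V k H A C ≃ₗ[k] integrals k H A C where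
  toFun ν := ⟨ν.toIntegral, ν.toIntegral_mem⟩
  invFun := V.ofIntegral
  map_add' ν ν' := by
    refine Subtype.ext (LinearMap.ext₂ fun c d => ?_)
    change (ν + ν').toIntegral c d = ν.toIntegral c d + ν'.toIntegral c d
    simp only [toIntegral_apply, ← map_add]
    rfl
  map_smul' x ν := by
    refine Subtype.ext (LinearMap.ext₂ fun c d => ?_)
    change (x • ν).toIntegral c d = x • ν.toIntegral c d
    rw [toIntegral_apply, toIntegral_apply, ← map_smul, ← map_smul]
    rfl
  left_inv ν := by
    refine V.ext_app fun M => TensorProduct.ext' fun c m => ?_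
    rw [ofIntegral_app, integralMap_tmul, app_tmul]
  right_inv φ := Subtype.ext (V.toIntegral_ofIntegral φ)

/-- By coassociativity the composite with `ρ` is `m ↦ ∑ m₍₀₎ φ(m₍₋₂₎, m₍₋₁₎)`; normalization
replaces the value of `φ` by `ε(m₍₋₁₎)`. -/
theorem V.isSplitting_ofIntegral (φ : integrals k H A C) (hφ : IsNormalized φ.1) :
    (V.ofIntegral φ).IsSplitting := by
  refine NatTrans.ext (funext fun M => DoiHopfMod.hom_ext _ _ _ _ (LinearMap.ext fun (m : M.carrier) => ?_))
  change integralMap k M.carrier φ.1 (coact k C m) = m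
  have h : ∀ z : C ⊗[k] M.carrier, bipairing k M.carrier φ.1
      (TensorProduct.assoc k C C _ ((comul (R := k)).rTensor _ z)) =
        TensorProduct.lid k _ ((counit (R := k)).rTensor _ z) := by
    intro z
    induction z with
    | zero => simp
    | add x y hx hy => simp only [map_add, hx, hy]
    | tmul e n =>
      rw [LinearMap.rTensor_tmul, bipairing_assoc_tmul, hφ, LinearMap.rTensor_tmul,
        TensorProduct.lid_tmul, Algebra.algebraMap_eq_smul_one, op_smul, op_one, smul_assoc,
        one_smul]
  have h1 : TensorProduct.assoc k C C _ ((comul (R := k)).rTensor _ (coact k C m)) =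
      (coact k C).lTensor C (coact k C m) := LeftComodule.coassoc m
  rw [integralMap, LinearMap.comp_apply, ← h1, h]
  exact LeftComodule.counit_coact m

theorem V.mul_eq_of_isSplitting {ν : V k H A C} (hν : ν.IsSplitting) (ν' : V k H A C) :
    ν' * ν = ν' := by
  change ν'.toNatTrans ≫ unitCoaction k H A C ≫ ν.toNatTrans = ν'.toNatTrans
  rw [show unitCoaction k H A C ≫ ν.toNatTrans = 𝟙 _ from hν, Category.comp_id]

end Correspondence

/-! ### Transport of the algebra structure from `V` to `V₃` and `V₄`. -/

section Subalgebras

variable {k : Type*} [CommRing k] {H : Type*} [Ring H] [Bialgebra k H]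
  {A : Type u} [Ring A] [Algebra k A] [ComoduleAlgebra k H A]
  {C : Type u} [AddCommGroup C] [Module k C] [Coalgebra k C] [Module Hᵐᵒᵖ C]
  [IsScalarTower k Hᵐᵒᵖ C] [ModuleCoalgebra k H C]

theorem toIntegral_ofIntegral_mul (φ ψ : integrals k H A C) (c : C) :
    (V.ofIntegral φ * V.ofIntegral ψ).toIntegral c =
      copMul k H φ.1 ψ.1 (comul (R := k) c) := by
  rw [V.toIntegral_mul, V.toIntegral_ofIntegral, V.toIntegral_ofIntegral]

/-- The product of two integrals is the integral of a product in `V`, hence again an integral. Both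
subalgebra claims rest on this. -/
theorem mem_integrals_of_copMul {φ ψ χ : C →ₗ[k] C →ₗ[k] A} (hφ : φ ∈ integrals k H A C)
    (hψ : ψ ∈ integrals k H A C) (hχ : ∀ c, χ c = copMul k H φ ψ (comul (R := k) c)) :
    χ ∈ integrals k H A C := by
  have h : χ = (V.ofIntegral ⟨φ, hφ⟩ * V.ofIntegral ⟨ψ, hψ⟩).toIntegral :=
    LinearMap.ext fun c => by rw [hχ, toIntegral_ofIntegral_mul]
  rw [h]
  exact V.toIntegral_mem _

theorem copMul_eq_of_isNormalized {φ ψ : C →ₗ[k] C →ₗ[k] A} (hφ : φ ∈ integrals k H A C)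
    (hψ : ψ ∈ integrals k H A C) (h : IsNormalized ψ) (c : C) :
    copMul k H φ ψ (comul (R := k) c) = φ c := by
  rw [← toIntegral_ofIntegral_mul ⟨φ, hφ⟩ ⟨ψ, hψ⟩,
    V.mul_eq_of_isSplitting (V.isSplitting_ofIntegral ⟨ψ, hψ⟩ h), V.toIntegral_ofIntegral]

variable (k H A C)

/-- `V₃` as a subalgebra of `#(C^cop ⊗ C, A)`. -/
def subalgebra₃ : NonUnitalSubalgebra k (Koppinen k H (Cop C ⊗[k] C) A) where
  __ := V₃ k H A C
  mul_mem' {θ θ'} hθ hθ' := mem_integrals_of_copMul hθ hθ' (bilin₃_mul k H θ θ')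

/-- `V₄` as a subalgebra of `Hom(C^cop, #(C, A))`. -/
def subalgebra₄ : NonUnitalSubalgebra k (WithConv (Cop C →ₗ[k] Koppinen k H C A)) where
  __ := V₄ k H A C
  mul_mem' {γ γ'} hγ hγ' := mem_integrals_of_copMul hγ hγ' (bilin₄_mul k H γ γ')

/-- The isomorphism of `V₃` with the module of integrals. -/
def integralEquiv₃ : subalgebra₃ k H A C ≃ₗ[k] integrals k H A C :=
  (bilin₃ k H A C).ofSubmodule' (integrals k H A C)

/-- The isomorphism of `V₄` with the module of integrals. -/
def integralEquiv₄ : subalgebra₄ k H A C ≃ₗ[k] integrals k H A C :=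
  (bilin₄ k H A C).ofSubmodule' (integrals k H A C)

/-- The algebra isomorphism `V₃ → V`. -/
def toNatTransHom : subalgebra₃ k H A C →ₙₐ[k] V k H A C where
  __ := (integralEquiv₃ k H A C ≪≫ₗ
    (V.integralEquiv k H A C).symm).toLinearMap.toDistribMulActionHom
  map_mul' θ θ' := by
    -- Two elements of `V` agree once their integrals do; on both sides the integral is the same
    -- `copMul` expression.
    refine (V.integralEquiv k H A C).injective (Subtype.ext (LinearMap.ext fun c => ?_))
    refine Eq.trans ?_ (toIntegral_ofIntegral_mul (integralEquiv₃ k H A C θ)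
      (integralEquiv₃ k H A C θ') c).symm
    refine Eq.trans ?_ (bilin₃_mul k H θ.1 θ'.1 c)
    exact LinearMap.congr_fun
      (V.toIntegral_ofIntegral (integralEquiv₃ k H A C (θ * θ'))) c

/-- The linear isomorphism `V₃ → V₄`. -/
def curryEquiv : subalgebra₃ k H A C ≃ₗ[k] subalgebra₄ k H A C :=
  integralEquiv₃ k H A C ≪≫ₗ (integralEquiv₄ k H A C).symm

theorem bilin₄_curryEquiv (θ : subalgebra₃ k H A C) :
    bilin₄ k H A C (curryEquiv k H A C θ) = bilin₃ k H A C θ :=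
  congrArg Subtype.val ((integralEquiv₄ k H A C).apply_symm_apply (integralEquiv₃ k H A C θ))

/-- The algebra isomorphism `V₃ → V₄`. -/
def curryHom : subalgebra₃ k H A C →ₙₐ[k] subalgebra₄ k H A C where
  __ := (curryEquiv k H A C).toLinearMap.toDistribMulActionHom
  map_mul' θ θ' := by
    have h := bilin₄_curryEquiv k H A C
    refine Subtype.ext ((bilin₄ k H A C).injective (LinearMap.ext fun c => ?_))
    refine ((LinearMap.congr_fun (h (θ * θ')) c).trans (bilin₃_mul k H θ.1 θ'.1 c)).trans ?_
    exact (congrArg₂ (fun φ ψ => copMul k H φ ψ (comul c)) (h θ) (h θ')).symm.trans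
      (bilin₄_mul k H _ _ c).symm

theorem gApp_g₁_g₂ (φ : C →ₗ[k] C →ₗ[k] A) (M : DoiHopfMod.{u} k H A C) :
    gApp k H (g₁ k (g₂ k (lift φ))) M = integralMap k M.carrier φ := by
  rw [gApp, counit_g₁_g₂]
  rfl

end Subalgebras

end

end DoiHopf

/-! ### Assembly of the theorem. -/

theorem theorem2p1p8 {k : Type*} [CommRing k] {H : Type*} [Ring H] [Bialgebra k H]
    {A : Type u} [Ring A] [Algebra k A] [DoiHopf.ComoduleAlgebra k H A]
    {C : Type u} [AddCommGroup C] [Module k C] [Coalgebra k C] [Module.Flat k C]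
    [Module Hᵐᵒᵖ C] [IsScalarTower k Hᵐᵒᵖ C] [DoiHopf.ModuleCoalgebra k H C] :
    ∃ (S₃ : NonUnitalSubalgebra k (DoiHopf.Koppinen k H (DoiHopf.Cop C ⊗[k] C) A))
      (S₄ : NonUnitalSubalgebra k (WithConv (DoiHopf.Cop C →ₗ[k] DoiHopf.Koppinen k H C A)))
      (h : S₃ →ₙₐ[k] DoiHopf.V k H A C) (f₃ : S₃ →ₙₐ[k] S₄),
      -- `V₃` and `V₄` are closed under multiplication
      S₃.toSubmodule = DoiHopf.V₃ k H A C ∧ S₄.toSubmodule = DoiHopf.V₄ k H A C ∧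
      -- `h` is the composite `g ∘ g₁ ∘ g₂`
      (∀ (θ : S₃) (M : DoiHopf.DoiHopfMod.{u} k H A C), (h θ).app M =
        DoiHopf.gApp k H (DoiHopf.g₁ k (DoiHopf.g₂ k
          (lift (DoiHopf.bilin₃ k H A C (θ : DoiHopf.Koppinen k H _ A))))) M) ∧
      -- `f₃` is the isomorphism `f₃(θ)(c)(d) = θ(c ⊗ d)`
      (∀ θ : S₃, DoiHopf.bilin₄ k H A C (f₃ θ) = DoiHopf.bilin₃ k H A C θ) ∧
      Function.Bijective f₃ ∧
      -- if `H` is a Hopf algebra, then `h` is an isomorphism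
      ((∃ hH : HopfAlgebra k H, hH.toBialgebra = ‹Bialgebra k H›) → Function.Bijective h) ∧
      -- normalized elements and splittings are right units
      (∀ θ : S₃, DoiHopf.IsNormalized (DoiHopf.bilin₃ k H A C θ) → ∀ θ' : S₃, θ' * θ = θ') ∧
      (∀ γ : S₄, DoiHopf.IsNormalized (DoiHopf.bilin₄ k H A C γ) → ∀ γ' : S₄, γ' * γ = γ') ∧
      (∀ ν : DoiHopf.V k H A C, ν.IsSplitting → ∀ ν' : DoiHopf.V k H A C, ν' * ν = ν') :=
  ⟨DoiHopf.subalgebra₃ k H A C, DoiHopf.subalgebra₄ k H A C, DoiHopf.toNatTransHom k H A C,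
    DoiHopf.curryHom k H A C, rfl, rfl, fun _ M => (DoiHopf.gApp_g₁_g₂ k H A C _ M).symm,
    DoiHopf.bilin₄_curryEquiv k H A C, (DoiHopf.curryEquiv k H A C).bijective,
    -- The map underlying `h` is this composite of linear isomorphisms.
    fun _ => (DoiHopf.integralEquiv₃ k H A C ≪≫ₗ
      (DoiHopf.V.integralEquiv k H A C).symm).bijective,
    fun θ hθ θ' => Subtype.ext ((DoiHopf.bilin₃ k H A C).injective (LinearMap.ext fun c =>
      (DoiHopf.bilin₃_mul k H θ'.1 θ.1 c).trans
        (DoiHopf.copMul_eq_of_isNormalized θ'.2 θ.2 hθ c))),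
    fun γ hγ γ' => Subtype.ext ((DoiHopf.bilin₄ k H A C).injective (LinearMap.ext fun c =>
      (DoiHopf.bilin₄_mul k H γ'.1 γ.1 c).trans
        (DoiHopf.copMul_eq_of_isNormalized γ'.2 γ.2 hγ c))),
    fun _ hν ν' => DoiHopf.V.mul_eq_of_isSplitting hν ν'⟩
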